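/- Let $\mathbb K$ be a (non-archimedean) local field with ring of integers $\mathfrak D$ and prime ideal $\mathfrak P$, let $dx$ be the Haar measure of $(\mathbb K,+)$ with $\int_{\mathfrak D}dx=1$, and let $|\cdot|$ be the absolute value given by $d(\alpha x)=|\alpha|\,dx$, $|0|=0$. Fix a continuous unitary character $e$ of $(\mathbb K,+)$ that is trivial on $\mathfrak D$ and nontrivial on $\mathfrak P^{-1}$, and let $\hat f$ denote the $L^2$-Fourier transform extending $\hat f(\xi)=\int_{\mathbb K}f(x)\,e(-\xi x)\,dx$. A function $\psi\in L^2(\mathbb K)$ is called an admissible wavelet if $c_\psi=\int_{\mathbb K}|\hat\psi(\xi)|^2\,|\xi|^{-1}d\xi<\infty$. For $a,b\in\mathbb K$, $a\ne0$, put $$\psi_{a,b}(x)=|a|^{-1/2}\,\psi\Big(\frac{x-b}{a}\Big),\qquad (K_\psi f)(a,b)=\int_{\mathbb K}f(x)\,\overline{\psi_{a,b}(x)}\,dx .$$ Let $\psi,\varphi,\chi$ be admissible wavelets with $c_\varphi\neq0$, and let $D(x,y,z)$ be a basic function for them, that is, a measurable function on $\mathbb K^3$ such that $D(\cdot,y,z)\in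 L^2(\mathbb K)$ for almost all $(y,z)$ and such that, for all $a\ne0$ and $b$, $$K_\varphi[D(\cdot,y,z)](a,b)=\overline{\psi_{a,b}(z)}\;\overline{\chi_{a,b}(y)}\qquad\text{for almost all }(y,z).$$ Define the translation $(\tau_xh)(y)=\int_{\mathbb K}D(x,y,z)\,h(z)\,dz$ and the associated convolution $(h\# g)(x)=\int_{\mathbb K}(\tau_xh)(y)\,g(y)\,dy$. **Theorem.** Let $h,g\in L^2(\mathbb K)$ be such that, for almost every $x$, the double integral $\iint_{\mathbb K^2} D(x,y,z)\,h(z)\,g(y)\,dy\,dz$ defining $(h\# g)(x)$ converges absolutely. Then $h\# g\in L^2(\mathbb K)$, and for all $a,b\in\mathbb K$ with $a\neq0$, $$K_\varphi[h\# g](a,b)=(K_\psi h)(a,b)\,(K_\chi g)(a,b).$$ -/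

import Mathlib

open MeasureTheory ValuativeRel Filter Topology ComplexConjugate
open scoped ENNReal NNReal

namespace LocalFieldWavelet

noncomputable section

variable {K : Type*} [Field K] [ValuativeRel K] [TopologicalSpace K]
  [IsNonarchimedeanLocalField K] [MeasurableSpace K] [BorelSpace K]

/-- The absolute value of a local field: the factor `|α|` by which multiplication by `α` scales
Haar measure, `d(α x) = |α| dx`, with `|0| = 0`. -/
def absVal (α : K) : ℝ :=
  open Classical in
  if h : α = 0 then 0 else ((distribHaarChar K (Units.mk0 α h) : ℝ≥0) : ℝ)

/-- The absolute value is the Haar modulus. -/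
theorem ofReal_absVal_mul (μ : Measure K) [μ.IsAddHaarMeasure] [μ.Regular] {α : K} (hα : α ≠ 0)
    (s : Set K) : ENNReal.ofReal (absVal α) * μ s = μ ((fun x => α * x) '' s) := by
  have h := distribHaarChar_mul μ (Units.mk0 α hα) s
  simp only [absVal, hα, dif_neg, not_false_eq_true, ENNReal.ofReal_coe_nnreal]
  exact h

/-- `e` is a continuous unitary character of the additive group of `K` that is trivial on the ring
of integers `𝔇`, and nontrivial on the fractional ideal `𝔓⁻¹ = {x | x 𝔓 ⊆ 𝔇}`, where `𝔓` is the
prime ideal of `𝔇`. -/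
structure IsFixedCharacter (e : AddChar K Circle) : Prop where
  continuous : Continuous e
  trivial_on_integers : ∀ x : K, valuation K x ≤ 1 → e x = 1
  nontrivial : ∃ x : K, (∀ y : K, valuation K y < 1 → valuation K (x * y) ≤ 1) ∧ e x ≠ 1

/-- `F` is the Fourier transform of `f ∈ L²(K)`: some sequence in `L¹ ∩ L²` tends to `f` in `L²`,
and its Fourier transforms `ξ ↦ ∫ u(x) e(-ξ x) dx` tend to `F` in `L²`. -/
def IsL2Fourier (e : AddChar K Circle) (μ : Measure K) (f F : K → ℂ) : Prop :=
  MemLp f 2 μ ∧ MemLp F 2 μ ∧ ∃ u : ℕ → K → ℂ,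
    (∀ n, MemLp (u n) 1 μ ∧ MemLp (u n) 2 μ) ∧
    Tendsto (fun n => eLpNorm (u n - f) 2 μ) atTop (𝓝 0) ∧
    Tendsto (fun n => eLpNorm (Fourier.fourierIntegral e μ (u n) - F) 2 μ) atTop (𝓝 0)

/-- The Fourier transform on `L²(K)` (determined almost everywhere). -/
def l2Fourier (e : AddChar K Circle) (μ : Measure K) (f : K → ℂ) : K → ℂ :=
  open Classical in
  if h : ∃ F, IsL2Fourier e μ f F then h.choose else 0

/-- The constant `c_ψ = ∫ |ψ̂(ξ)|² / |ξ| dξ`, with values in `[0, ∞]`. -/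
def admissibilityConstant (e : AddChar K Circle) (μ : Measure K) (ψ : K → ℂ) : ℝ≥0∞ :=
  ∫⁻ ξ, ‖l2Fourier e μ ψ ξ‖ₑ ^ 2 / ENNReal.ofReal (absVal ξ) ∂μ

/-- Admissible wavelets: `ψ ∈ L²(K)` and `c_ψ < ∞`. -/
def IsAdmissibleWavelet (e : AddChar K Circle) (μ : Measure K) (ψ : K → ℂ) : Prop :=
  MemLp ψ 2 μ ∧ admissibilityConstant e μ ψ < ∞

/-- The daughter wavelets `ψ_{a,b}(x) = |a|^{-1/2} ψ((x - b) / a)`. -/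
def daughter (ψ : K → ℂ) (a b x : K) : ℂ :=
  ((1 / √(absVal a) : ℝ) : ℂ) * ψ ((x - b) / a)

/-- The continuous wavelet transform `(K_ψ f)(a,b) = ∫ f(x) conj(ψ_{a,b}(x)) dx`. -/
def cwt (μ : Measure K) (ψ f : K → ℂ) (a b : K) : ℂ :=
  ∫ x, f x * conj (daughter ψ a b x) ∂μ

/-- `D` is the basic function of the wavelets `ψ, φ, χ`: a measurable function with
`D(·,y,z) ∈ L²(K)` and
`K_φ[D(·,y,z)](a,b) = conj(ψ_{a,b}(z)) conj(χ_{a,b}(y))`, for almost all `(y,z)`. -/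
structure IsBasicFunction (μ : Measure K) (ψ φ χ : K → ℂ) (D : K → K → K → ℂ) : Prop where
  aestronglyMeasurable :
    AEStronglyMeasurable (fun p : K × K × K => D p.1 p.2.1 p.2.2) (μ.prod (μ.prod μ))
  memLp : ∀ᵐ p : K × K ∂(μ.prod μ), MemLp (fun x => D x p.1 p.2) 2 μ
  cwt_eq : ∀ a b : K, a ≠ 0 → ∀ᵐ p : K × K ∂(μ.prod μ),
    cwt μ φ (fun x => D x p.1 p.2) a b = conj (daughter ψ a b p.2) * conj (daughter χ a b p.1)

/-- The translation `(τ_x h)(y) = ∫ D(x,y,z) h(z) dz`. -/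
def translation (μ : Measure K) (D : K → K → K → ℂ) (x : K) (h : K → ℂ) (y : K) : ℂ :=
  ∫ z, D x y z * h z ∂μ

/-- The associated convolution `(h # g)(x) = ∫ (τ_x h)(y) g(y) dy`. -/
def assocConv (μ : Measure K) (D : K → K → K → ℂ) (h g : K → ℂ) (x : K) : ℂ :=
  ∫ y, translation μ D x h y * g y ∂μ

end

end LocalFieldWavelet

/-!
The wavelet transform `W_φ : f ↦ K_φ f` maps `L²(K)` into `L²(|a|⁻² da db)` and satisfies
`‖W_φ f‖² = c_φ ‖f‖²`. For a pair `p = (y, z)`, the transform of `D(·, y, z)` is the kernel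
`k_p(a, b) = conj ψ_{a,b}(z) conj χ_{a,b}(y)`, whose norm is `C / |y - z|` because the affine group
acts simply transitively on pairs of distinct points; the existence of a basic function forces
`C < ∞`.

For `H ∈ L²(|a|⁻² da db)` put `T_H(h, g) = ∬ K_ψ h K_χ g H` and `S_H(p) = ∬ k_p H`. The point is
that `T_H(h, g) = ∬ S_H(y, z) h(z) g(y) dy dz` as soon as the right-hand side converges absolutely,
although the singularity `|y - z|⁻¹` prevents an appeal to Fubini. Replacing `h` and `g` by
`e(ξ·) h` and `e(-ξ·) g` multiplies `h(z) g(y)` by `e(ξ(z - y))`, and `|e(ξt) - 1| ≤ 2 |ξ| |t|`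
cancels the singularity, so both sides change by the same amount. As `ξ → ∞`, both modulated sides
tend to `0` by the Riemann–Lebesgue lemma.

Taking `H = conj (W_φ w)`, for which `S_H(y, z) = c_φ ∫ D(x, y, z) conj (w x) dx`, gives
`c_φ ⟪w, h # g⟫ = ⟪W_φ w, K_ψ h K_χ g⟫` for enough indicator functions `w` to identify `h # g` with
`c_φ⁻¹ W_φ† (K_ψ h K_χ g) ∈ L²(K)`. The choice `w = φ_{a,b}`, for which
`S_H(y, z) = c_φ conj ψ_{a,b}(z) conj χ_{a,b}(y)`, then evaluates `K_φ[h # g]` at each `(a, b)`.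
-/

namespace LocalFieldWavelet

section LocalField

variable {K : Type*} [Field K] [ValuativeRel K]

theorem antitone_valuation_pow {ϖ : K} (h1 : valuation K ϖ < 1) :
    Antitone fun n : ℕ => valuation K (ϖ ^ n) := by
  simpa only [map_pow] using pow_right_anti₀ zero_le h1.le

variable [TopologicalSpace K] [IsNonarchimedeanLocalField K]

theorem exists_valuation_lt_one (K : Type*) [Field K] [ValuativeRel K] [TopologicalSpace K]
    [IsNonarchimedeanLocalField K] : ∃ ϖ : K, ϖ ≠ 0 ∧ valuation K ϖ < 1 := by
  obtain ⟨ϖ, h0, h1⟩ := Valuation.IsNontrivial.exists_lt_one (v := valuation K)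
  exact ⟨ϖ, by simpa using h0, h1⟩

theorem exists_valuation_pow_lt {ϖ : K} (h1 : valuation K ϖ < 1) {γ : ValueGroupWithZero K}
    (hγ : γ ≠ 0) : ∃ n : ℕ, valuation K (ϖ ^ n) < γ := by
  have : MulArchimedean (ValueGroupWithZero K) :=
    ValuativeRel.isRankLeOne_iff_mulArchimedean.mp inferInstance
  obtain ⟨n, hn⟩ := exists_pow_lt₀ h1 (Units.mk0 γ hγ)
  exact ⟨n, by simpa using hn⟩

theorem eventually_valuation_le_inv_pow {ϖ : K} (h0 : ϖ ≠ 0) (h1 : valuation K ϖ < 1) (x : K) :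
    ∀ᶠ n : ℕ in atTop, valuation K x ≤ valuation K (ϖ ^ n)⁻¹ := by
  rcases eq_or_ne x 0 with rfl | hx
  · simp
  obtain ⟨n, hn⟩ := exists_valuation_pow_lt h1 (γ := valuation K x⁻¹) (by simpa using hx)
  filter_upwards [eventually_ge_atTop n] with m hm
  have hm' := (antitone_valuation_pow h1 hm).trans hn.le
  rw [map_inv₀] at hm' ⊢
  exact (le_inv_comm₀ (by simp [zero_lt_iff, h0]) (by simpa [zero_lt_iff] using hx)).1 hm'

theorem tendsto_pow_zero {ϖ : K} (h1 : valuation K ϖ < 1) :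
    Tendsto (fun n : ℕ => ϖ ^ n) atTop (𝓝 0) := by
  refine (IsValuativeTopology.hasBasis_nhds_zero' K).tendsto_right_iff.2 fun γ hγ => ?_
  obtain ⟨n, hn⟩ := exists_valuation_pow_lt h1 hγ
  filter_upwards [eventually_ge_atTop n] with m hm
  exact (antitone_valuation_pow h1 hm).trans_lt hn

instance : (𝓝[≠] (0 : K)).NeBot := by
  obtain ⟨ϖ, h0, h1⟩ := exists_valuation_lt_one K
  have : Tendsto (fun n : ℕ => ϖ ^ n) atTop (𝓝[≠] 0) :=
    tendsto_nhdsWithin_iff.2 ⟨tendsto_pow_zero h1, .of_forall fun n => pow_ne_zero n h0⟩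
  exact this.neBot

instance : (𝓝 (0 : K)).IsCountablyGenerated := by
  obtain ⟨ϖ, h0, h1⟩ := exists_valuation_lt_one K
  refine HasCountableBasis.isCountablyGenerated (ι := ℕ) (p := fun _ => True)
    (s := fun n => {x : K | valuation K x < valuation K (ϖ ^ n)}) ⟨?_, Set.to_countable _⟩
  refine (IsValuativeTopology.hasBasis_nhds_zero' K).to_hasBasis (fun γ hγ => ?_) (fun n _ => ?_)
  · obtain ⟨n, hn⟩ := exists_valuation_pow_lt h1 hγ
    exact ⟨n, trivial, fun x hx => lt_trans hx hn⟩
  · exact ⟨valuation K (ϖ ^ n), by simp [h0], subset_rfl⟩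

instance : SigmaCompactSpace K := by
  obtain ⟨ϖ, h0, h1⟩ := exists_valuation_lt_one K
  refine ⟨⟨fun n => {x | valuation K x ≤ valuation K (ϖ ^ n)⁻¹},
    fun n => IsNonarchimedeanLocalField.isCompact_closedBall K _, ?_⟩⟩
  exact Set.iUnion_eq_univ_iff.2 fun x => (eventually_valuation_le_inv_pow h0 h1 x).exists

instance : SecondCountableTopology K := by
  let := IsTopologicalAddGroup.rightUniformSpace K
  have := isUniformAddGroup_of_addCommGroup (G := K)
  have : (uniformity K).IsCountablyGenerated := IsUniformAddGroup.uniformity_countably_generated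
  let := UniformSpace.pseudoMetricSpace K
  infer_instance

instance : T2Space K := by
  refine IsTopologicalAddGroup.t2Space_of_zero_sep fun x hx => ?_
  refine ⟨{y | valuation K y < valuation K x}, ?_, by simp⟩
  exact (IsValuativeTopology.hasBasis_nhds_zero' K).mem_of_mem (by simpa using hx)

theorem absVal_zero : absVal (0 : K) = 0 := by simp [absVal]

theorem absVal_pos {α : K} (hα : α ≠ 0) : 0 < absVal α := by
  simp only [absVal, hα, dif_neg, not_false_eq_true]
  exact_mod_cast distribHaarChar_pos

theorem absVal_nonneg (α : K) : 0 ≤ absVal α := by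
  rcases eq_or_ne α 0 with rfl | h
  · rw [absVal_zero]
  · exact (absVal_pos h).le

theorem absVal_mul (α β : K) : absVal (α * β) = absVal α * absVal β := by
  rcases eq_or_ne α 0 with rfl | hα
  · simp [absVal_zero]
  rcases eq_or_ne β 0 with rfl | hβ
  · simp [absVal_zero]
  simp only [absVal, hα, hβ, mul_eq_zero, or_self, dif_neg, not_false_eq_true]
  rw [← NNReal.coe_mul, ← map_mul]
  congr 2
  ext; simp

theorem absVal_one : absVal (1 : K) = 1 := by
  have h := absVal_mul (1 : K) 1
  rw [mul_one] at h
  exact (mul_eq_left₀ (absVal_pos one_ne_zero).ne').1 h.symm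

theorem absVal_inv (α : K) : absVal α⁻¹ = (absVal α)⁻¹ := by
  rcases eq_or_ne α 0 with rfl | hα
  · simp [absVal_zero]
  · exact eq_inv_of_mul_eq_one_left (by rw [← absVal_mul, inv_mul_cancel₀ hα, absVal_one])

theorem absVal_neg (α : K) : absVal (-α) = absVal α := by
  have h := absVal_mul (-α) (-α)
  rw [neg_mul_neg, absVal_mul] at h
  exact (mul_self_inj (absVal_nonneg _) (absVal_nonneg _)).1 h.symm

/-- The absolute value `|α|` as an extended nonnegative real, for use in Lebesgue integrals. -/
noncomputable def eAbs (α : K) : ℝ≥0∞ := ENNReal.ofReal (absVal α)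

theorem eAbs_ne_top (α : K) : eAbs α ≠ ∞ := ENNReal.ofReal_ne_top

theorem eAbs_ne_zero {α : K} (hα : α ≠ 0) : eAbs α ≠ 0 := by
  simpa [eAbs] using absVal_pos hα

theorem eAbs_mul (α β : K) : eAbs (α * β) = eAbs α * eAbs β := by
  simp only [eAbs, absVal_mul, ENNReal.ofReal_mul (absVal_nonneg α)]

theorem eAbs_inv {α : K} (hα : α ≠ 0) : eAbs α⁻¹ = (eAbs α)⁻¹ := by
  simp only [eAbs, absVal_inv, ENNReal.ofReal_inv_of_pos (absVal_pos hα)]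

theorem eAbs_neg (α : K) : eAbs (-α) = eAbs α := by
  simp only [eAbs, absVal_neg]

variable [MeasurableSpace K] [BorelSpace K]

theorem measurableSet_valuation_le (γ : ValueGroupWithZero K) :
    MeasurableSet {x : K | valuation K x ≤ γ} :=
  (IsNonarchimedeanLocalField.isCompact_closedBall K γ).isClosed.measurableSet

theorem aecover_valuation_le_inv_pow (μ : Measure K) {ϖ : K} (h0 : ϖ ≠ 0)
    (h1 : valuation K ϖ < 1) :
    AECover μ atTop fun n : ℕ => {x | valuation K x ≤ valuation K (ϖ ^ n)⁻¹} :=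
  ⟨ae_of_all _ fun x => eventually_valuation_le_inv_pow h0 h1 x,
    fun _ => measurableSet_valuation_le _⟩

variable (μ : Measure K) [μ.IsAddHaarMeasure]

theorem map_mul_left {α : K} (hα : α ≠ 0) :
    μ.map (fun x => α * x) = (eAbs α)⁻¹ • μ := by
  ext s hs
  rw [Measure.map_apply (measurable_const_mul α) hs, Measure.smul_apply, smul_eq_mul,
    ← eAbs_inv hα, eAbs, ofReal_absVal_mul μ (inv_ne_zero hα)]
  have himage := (Equiv.mulLeft₀ α hα).image_symm_eq_preimage s
  exact congrArg μ (by simpa using himage.symm)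

variable {μ}

theorem measure_valuation_le (hμ : μ {x : K | valuation K x ≤ 1} = 1) {t : K} (ht : t ≠ 0) :
    μ {x : K | valuation K x ≤ valuation K t} = eAbs t := by
  rw [eAbs, ← mul_one (ENNReal.ofReal _), ← hμ, ofReal_absVal_mul μ ht]
  have himage := (Equiv.mulLeft₀ t ht).image_eq_preimage_symm {x : K | valuation K x ≤ 1}
  have ht0 : 0 < valuation K t := by simpa [zero_lt_iff] using ht
  refine congrArg μ (.trans ?_ himage.symm)
  ext x
  simp [inv_mul_le_one₀ ht0]

theorem absVal_le_absVal (hμ : μ {x : K | valuation K x ≤ 1} = 1) {s t : K} (hs : s ≠ 0)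
    (ht : t ≠ 0) (h : valuation K s ≤ valuation K t) : absVal s ≤ absVal t := by
  rw [← ENNReal.ofReal_le_ofReal_iff (absVal_nonneg t)]
  change eAbs s ≤ eAbs t
  rw [← measure_valuation_le hμ hs, ← measure_valuation_le hμ ht]
  exact measure_mono fun x (hx : valuation K x ≤ _) => hx.trans h

theorem measurable_absVal (hμ : μ {x : K | valuation K x ≤ 1} = 1) :
    Measurable (absVal : K → ℝ) := by
  have locally_const : ContinuousOn (absVal : K → ℝ) {0}ᶜ := by
    intro x hx
    refine ContinuousAt.continuousWithinAt (.congr (f := fun _ => absVal x) continuousAt_const ?_)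
    filter_upwards [(valuation K).locally_const (x := x) (by simpa using hx)] with y hy
    have hy0 : y ≠ 0 := by
      rintro rfl
      exact hx (by simpa using hy.symm)
    exact le_antisymm (absVal_le_absVal hμ hx hy0 hy.ge) (absVal_le_absVal hμ hy0 hx hy.le)
  exact measurable_of_measurable_on_compl_singleton 0
    (continuousOn_iff_continuous_domRestrict.1 locally_const).measurable

end LocalField

section RiemannLebesgue

variable {G : Type*} [AddCommGroup G] [TopologicalSpace G] [IsTopologicalAddGroup G]
  [MeasurableSpace G] [BorelSpace G] {ρ : Measure G} [ρ.IsAddHaarMeasure]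

theorem norm_integral_mul_addChar_mul_le {W : G → ℂ} (hW : Integrable W ρ) {E : AddChar G Circle}
    (hE : Continuous E) (v : G) :
    ‖∫ x, W x * E x ∂ρ‖ * ‖1 - (E v : ℂ)‖ ≤ ∫ x, ‖W (x + v) - W x‖ ∂ρ := by
  have integrable_mul : ∀ {U : G → ℂ}, Integrable U ρ → Integrable (fun x => U x * E x) ρ :=
    fun hU => hU.mul_bdd (c := 1) (by fun_prop) (ae_of_all _ fun x => (Circle.norm_coe _).le)
  have shift : ∫ x, W x * E x ∂ρ = E v * ∫ x, W (x + v) * E x ∂ρ := by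
    rw [← integral_add_right_eq_self (fun x => W x * E x) v, ← integral_const_mul]
    refine integral_congr_ae (ae_of_all _ fun x => ?_)
    simp only [AddChar.map_add_eq_mul, Circle.coe_mul]
    ring
  have difference : (∫ x, W x * E x ∂ρ) * (1 - E v) =
      E v * ∫ x, (W (x + v) - W x) * E x ∂ρ := by
    simp only [sub_mul]
    rw [integral_sub (integrable_mul (hW.comp_add_right v)) (integrable_mul hW)]
    linear_combination shift
  rw [← norm_mul, difference, norm_mul, Circle.norm_coe, one_mul]
  exact (norm_integral_le_integral_norm _).trans_eq
    (by simp only [norm_mul, Circle.norm_coe, mul_one])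

variable [LocallyCompactSpace G] [SecondCountableTopology G] [T2Space G]

theorem tendsto_eLpNorm_translate_sub {p : ℝ≥0∞} (hp1 : 1 ≤ p) (hp : p ≠ ∞) {f : G → ℂ}
    (hf : MemLp f p ρ) :
    Tendsto (fun s => eLpNorm (fun x => f (x + s) - f x) p ρ) (𝓝 0) (𝓝 0) := by
  have : Fact (1 ≤ p) := ⟨hp1⟩
  let T : G → C(G, G) := fun s => ⟨fun x => x + s, by fun_prop⟩
  have hT : Continuous T :=
    (ContinuousMap.curry ⟨fun q : G × G => q.2 + q.1, by fun_prop⟩).continuous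
  have hTm : ∀ s, MeasurePreserving (T s) ρ ρ := fun s => measurePreserving_add_right ρ s
  have key := Tendsto.compMeasurePreservingLp (p := p) (E := ℂ) (l := 𝓝 (0 : G))
    (f := fun _ : G => hf.toLp f) tendsto_const_nhds hT.continuousAt hTm (hTm 0) hp
  rw [Lp.tendsto_Lp_iff_tendsto_eLpNorm'] at key
  refine key.congr fun s => eLpNorm_congr_ae ?_
  simp only [Lp.toLp_compMeasurePreserving hf]
  filter_upwards [(hf.comp_measurePreserving (hTm s)).coeFn_toLp,
    (hf.comp_measurePreserving (hTm 0)).coeFn_toLp] with x hs h0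
  rw [Pi.sub_apply, hs, h0]
  simp [T]

theorem tendsto_integral_mul_addChar {ι : Type*} {l : Filter ι} {W : G → ℂ} (hW : Integrable W ρ)
    {E : ι → AddChar G Circle} (hE : ∀ i, Continuous (E i)) {v : ι → G} (hv : Tendsto v l (𝓝 0))
    {c : Circle} (hc : c ≠ 1) (hEv : ∀ i, E i (v i) = c) :
    Tendsto (fun i => ∫ x, W x * E i x ∂ρ) l (𝓝 0) := by
  have hlim : Tendsto (fun i => ∫ x, ‖W (x + v i) - W x‖ ∂ρ) l (𝓝 0) := by
    have := (ENNReal.tendsto_toReal ENNReal.zero_ne_top).comp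
      ((tendsto_eLpNorm_translate_sub le_rfl ENNReal.one_ne_top
        (memLp_one_iff_integrable.2 hW)).comp hv)
    refine this.congr fun i => ?_
    rw [Function.comp_apply, Function.comp_apply, eLpNorm_one_eq_lintegral_enorm]
    exact (integral_norm_eq_lintegral_enorm ((hW.comp_add_right _).sub hW).1).symm
  have hc0 : 0 < ‖1 - (c : ℂ)‖ :=
    norm_pos_iff.2 (sub_ne_zero.2 fun h => hc (Circle.coe_eq_one.1 h.symm))
  refine squeeze_zero_norm (fun i => (le_div_iff₀ hc0).2 ?_)
    (by simpa using hlim.div_const ‖1 - (c : ℂ)‖)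
  simpa only [hEv] using norm_integral_mul_addChar_mul_le hW (hE i) (v i)

end RiemannLebesgue

section SquareIntegrable

variable {X : Type*} [MeasurableSpace X] {ν : Measure X}

theorem eLpNorm_two_sq (f : X → ℂ) : eLpNorm f 2 ν ^ 2 = ∫⁻ x, ‖f x‖ₑ ^ 2 ∂ν := by
  simpa using eLpNorm_nnreal_pow_eq_lintegral (μ := ν) (f := f) (p := 2) two_ne_zero

theorem memLp_two_of_lintegral_ne_top {f : X → ℂ} (hf : AEStronglyMeasurable f ν)
    (h : ∫⁻ x, ‖f x‖ₑ ^ 2 ∂ν ≠ ∞) : MemLp f 2 ν := by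
  refine ⟨hf, lt_top_iff_ne_top.2 fun htop => h ?_⟩
  rw [← eLpNorm_two_sq, htop, ENNReal.top_pow two_ne_zero]

theorem lintegral_enorm_sq_ne_top {f : X → ℂ} (hf : MemLp f 2 ν) : ∫⁻ x, ‖f x‖ₑ ^ 2 ∂ν ≠ ∞ := by
  rw [← eLpNorm_two_sq]
  exact ENNReal.pow_ne_top hf.2.ne

theorem integral_mul_conj_self (f : X → ℂ) :
    ∫ x, f x * conj (f x) ∂ν = ((∫ x, ‖f x‖ ^ 2 ∂ν : ℝ) : ℂ) := by
  rw [← integral_complex_ofReal]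
  simp only [Complex.mul_conj', Complex.ofReal_pow]

theorem ofReal_integral_norm_sq {f : X → ℂ} (hf : MemLp f 2 ν) :
    ENNReal.ofReal (∫ x, ‖f x‖ ^ 2 ∂ν) = ∫⁻ x, ‖f x‖ₑ ^ 2 ∂ν := by
  rw [ofReal_integral_eq_lintegral_ofReal hf.norm.integrable_sq
    (ae_of_all _ fun x => sq_nonneg _)]
  simp [ENNReal.ofReal_pow]

theorem inner_toLp {f g : X → ℂ} (hf : MemLp f 2 ν) (hg : MemLp g 2 ν) :
    inner ℂ (hg.toLp g) (hf.toLp f) = ∫ x, f x * conj (g x) ∂ν := by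
  rw [L2.inner_def]
  refine integral_congr_ae ?_
  filter_upwards [hf.coeFn_toLp, hg.coeFn_toLp] with x hfx hgx
  rw [hfx, hgx, RCLike.inner_apply]

theorem memLp_conj {f : X → ℂ} {p : ℝ≥0∞} (hf : MemLp f p ν) :
    MemLp (fun x => conj (f x)) p ν := hf.star

theorem norm_integral_mul_le {f g : X → ℂ} (hf : MemLp f 2 ν) (hg : MemLp g 2 ν) :
    ‖∫ x, f x * g x ∂ν‖ ≤ (eLpNorm f 2 ν).toReal * (eLpNorm g 2 ν).toReal := by
  have h := norm_inner_le_norm (𝕜 := ℂ) ((memLp_conj hg).toLp _) (hf.toLp f)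
  rw [inner_toLp hf (memLp_conj hg), Lp.norm_toLp, Lp.norm_toLp, mul_comm] at h
  simpa only [Complex.conj_conj, eLpNorm_congr_norm_ae (f := fun x => conj (g x)) (g := g)
    (ae_of_all ν fun _ => RCLike.norm_conj _)] using h

theorem inner_eq_mul_inner_of_norm_sq_eq {E F : Type*} [SeminormedAddCommGroup E]
    [InnerProductSpace ℂ E] [SeminormedAddCommGroup F] [InnerProductSpace ℂ F] {x y : E} {u v : F}
    {k : ℝ} (h : ∀ c : ℂ, ‖u + c • v‖ ^ 2 = k * ‖x + c • y‖ ^ 2) :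
    inner ℂ u v = k * inner ℂ x y := by
  have h1 := congrArg (Complex.ofReal) (h 1)
  have h2 := congrArg (Complex.ofReal) (h (-1))
  have h3 := congrArg (Complex.ofReal) (h Complex.I)
  have h4 := congrArg (Complex.ofReal) (h (-Complex.I))
  rw [inner_eq_sum_norm_sq_div_four, inner_eq_sum_norm_sq_div_four x]
  simp only [one_smul, neg_smul, ← sub_eq_add_neg, Complex.ofReal_mul, Complex.ofReal_pow]
    at h1 h2 h3 h4
  simp only [Complex.coe_algebraMap, RCLike.I_to_complex]
  rw [h1, h2, h3, h4]
  ring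

theorem tendsto_eLpNorm_two_zero_of_dominated {u : ℕ → X → ℂ} {f : X → ℂ} (hf : MemLp f 2 ν)
    (hu : ∀ n, AEStronglyMeasurable (u n) ν) (hbound : ∀ n, ∀ᵐ x ∂ν, ‖u n x‖ ≤ ‖f x‖)
    (hlim : ∀ᵐ x ∂ν, Tendsto (fun n => u n x) atTop (𝓝 0)) :
    Tendsto (fun n => eLpNorm (u n) 2 ν) atTop (𝓝 0) := by
  have hsq : Tendsto (fun n => ∫⁻ x, ‖u n x‖ₑ ^ 2 ∂ν) atTop (𝓝 (∫⁻ _, 0 ∂ν)) := by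
    refine tendsto_lintegral_of_dominated_convergence' (fun x => ‖f x‖ₑ ^ 2)
      (fun n => (hu n).enorm.pow_const 2) (fun n => (hbound n).mono fun x hx => ?_)
      (lintegral_enorm_sq_ne_top hf) (hlim.mono fun x hx => ?_)
    · exact pow_le_pow_left₀ zero_le (enorm_le_iff_norm_le.2 hx) 2
    · simpa only [enorm_zero, Function.comp_def, zero_pow two_ne_zero] using
        ((ENNReal.continuous_pow 2).tendsto ‖(0 : ℂ)‖ₑ).comp hx.enorm
  have hroot := ((ENNReal.continuous_rpow_const (y := (2⁻¹ : ℝ))).tendsto 0).comp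
    (by simpa only [lintegral_zero] using hsq)
  rw [ENNReal.zero_rpow_of_pos (by norm_num)] at hroot
  refine hroot.congr fun n => ?_
  rw [Function.comp_apply, ← eLpNorm_two_sq]
  exact ENNReal.pow_rpow_inv_natCast two_ne_zero _

theorem tendsto_eLpNorm_two_indicator_sub {f : X → ℂ} (hf : MemLp f 2 ν) {V : ℕ → Set X}
    (hV : AECover ν atTop V) :
    Tendsto (fun n => eLpNorm ((V n).indicator f - f) 2 ν) atTop (𝓝 0) := by
  refine tendsto_eLpNorm_two_zero_of_dominated hf
    (fun n => (hf.1.indicator (hV.measurableSet n)).sub hf.1) (fun n => ae_of_all _ fun x => ?_)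
    (hV.ae_eventually_mem.mono fun x hx => ?_)
  · by_cases hx : x ∈ V n <;> simp [hx]
  · exact tendsto_const_nhds.congr' (hx.mono fun n hn => by simp [hn])

theorem exists_integrable_approx {f : X → ℂ} (hf : MemLp f 2 ν) :
    ∃ u : ℕ → X → ℂ, (∀ n, MemLp (u n) 1 ν ∧ MemLp (u n) 2 ν) ∧
      Tendsto (fun n => eLpNorm (u n - f) 2 ν) atTop (𝓝 0) := by
  obtain ⟨δ, -, hδ, hδ0⟩ := exists_seq_strictAnti_tendsto' (zero_lt_one' ℝ≥0∞)
  choose u hu hu2 using fun n =>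
    hf.exists_simpleFunc_eLpNorm_sub_lt ENNReal.ofNat_ne_top (hδ n).1.ne'
  refine ⟨fun n => u n, fun n => ⟨?_, hu2 n⟩, ?_⟩
  · exact memLp_one_iff_integrable.2
      ((SimpleFunc.memLp_iff_integrable two_ne_zero ENNReal.ofNat_ne_top).1 (hu2 n))
  · exact tendsto_of_tendsto_of_tendsto_of_le_of_le tendsto_const_nhds hδ0 (fun n => zero_le)
      fun n => (eLpNorm_sub_comm _ _ _ _).trans_le (hu n).le

end SquareIntegrable

section Autocorrelation

variable {G : Type*} [AddCommGroup G] [MeasurableSpace G] {ρ : Measure G}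

/-- The autocorrelation `s ↦ ∫ f(y + s) conj(f(y)) dy` of a function on a group, the function whose
Fourier transform is `|f̂|²`. -/
noncomputable def autocorrelation (ρ : Measure G) (f : G → ℂ) (s : G) : ℂ :=
  ∫ y, f (y + s) * conj (f y) ∂ρ

theorem autocorrelation_zero (f : G → ℂ) :
    autocorrelation ρ f 0 = ((∫ y, ‖f y‖ ^ 2 ∂ρ : ℝ) : ℂ) := by
  simp only [autocorrelation, add_zero, integral_mul_conj_self]

theorem setIntegral_addChar_eq_zero [MeasurableAdd G] [ρ.IsAddRightInvariant] {V : AddSubgroup G}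
    (hV : MeasurableSet (V : Set G)) {E : AddChar G Circle} {v : G} (hv : v ∈ V) (hEv : E v ≠ 1) :
    ∫ ξ in V, (E ξ : ℂ) ∂ρ = 0 := by
  have hshift : ∫ ξ in V, (E ξ : ℂ) ∂ρ = E v * ∫ ξ in V, (E ξ : ℂ) ∂ρ := by
    rw [← integral_indicator hV, ← integral_const_mul, ← integral_add_right_eq_self _ v]
    congr with ξ
    by_cases hξ : ξ ∈ V <;>
      simp [hξ, V.add_mem_cancel_right hv, AddChar.map_add_eq_mul, mul_comm]
  have hne : (E v : ℂ) ≠ 1 := fun h => hEv (Circle.coe_eq_one.1 h)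
  exact (mul_left_eq_self₀.1 hshift.symm).resolve_left hne

variable [TopologicalSpace G] [IsTopologicalAddGroup G] [BorelSpace G] [SecondCountableTopology G]
  [ρ.IsAddHaarMeasure]

theorem integrable_mul_conj_add [SFinite ρ] {f : G → ℂ} (hf : Integrable f ρ) :
    Integrable (fun p : G × G => f (p.1 + p.2) * conj (f p.1)) (ρ.prod ρ) := by
  have hff : Integrable (fun p : G × G => conj (f p.1) * f p.2) (ρ.prod ρ) :=
    (memLp_one_iff_integrable.1 (memLp_conj (memLp_one_iff_integrable.2 hf))).mul_prod hf
  simpa only [Function.comp_def, mul_comm] using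
    (measurePreserving_prod_add ρ ρ).integrable_comp_of_integrable hff

theorem integrable_autocorrelation [SFinite ρ] {f : G → ℂ} (hf : Integrable f ρ) :
    Integrable (autocorrelation ρ f) ρ :=
  (integrable_mul_conj_add hf).integral_prod_right

theorem continuousAt_autocorrelation [LocallyCompactSpace G] [T2Space G] {f : G → ℂ}
    (hf : MemLp f 2 ρ) : ContinuousAt (autocorrelation ρ f) 0 := by
  have hs : ∀ s, MemLp (fun y => f (y + s)) 2 ρ := fun s =>
    hf.comp_measurePreserving (measurePreserving_add_right ρ s)
  have hconj := memLp_conj hf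
  have hdiff : ∀ s, autocorrelation ρ f s - autocorrelation ρ f 0 =
      ∫ y, (f (y + s) - f y) * conj (f y) ∂ρ := fun s => by
    have hint : ∀ s, Integrable (fun y => f (y + s) * conj (f y)) ρ := fun s =>
      (hs s).integrable_mul hconj
    rw [autocorrelation, autocorrelation, ← integral_sub (hint s) (hint 0)]
    simp only [add_zero, sub_mul]
  have hnorm := (ENNReal.tendsto_toReal ENNReal.zero_ne_top).comp
    (tendsto_eLpNorm_translate_sub one_le_two ENNReal.ofNat_ne_top hf)
  refine tendsto_iff_norm_sub_tendsto_zero.2 (squeeze_zero (fun s => norm_nonneg _) (fun s => ?_)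
    (by simpa using hnorm.mul_const (eLpNorm (fun y => conj (f y)) 2 ρ).toReal))
  rw [hdiff]
  exact norm_integral_mul_le ((hs s).sub hf) hconj

end Autocorrelation

section Plancherel

theorem fourierIntegral_apply {K : Type*} [CommRing K] [MeasurableSpace K] (e : AddChar K Circle)
    (μ : Measure K) (f : K → ℂ) (ξ : K) :
    Fourier.fourierIntegral e μ f ξ = ∫ x, (e (-(x * ξ)) : ℂ) * f x ∂μ := by
  simp only [Fourier.fourierIntegral_def, Circle.smul_def, smul_eq_mul]

variable {K : Type*} [Field K] [ValuativeRel K] [TopologicalSpace K] {e : AddChar K Circle}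

theorem IsFixedCharacter.exists_valuation_le (he : IsFixedCharacter e) {s : K}
    (hs : 1 < valuation K s) : ∃ x : K, valuation K x ≤ valuation K s ∧ e x ≠ 1 := by
  obtain ⟨x, hx, hex⟩ := he.nontrivial
  refine ⟨x, ?_, hex⟩
  have := hx s⁻¹ (by rw [map_inv₀]; exact inv_lt_one_of_one_lt₀ hs)
  rwa [map_mul, map_inv₀, ← div_eq_mul_inv, div_le_one₀ (zero_lt_one.trans hs)] at this

variable [IsNonarchimedeanLocalField K] [MeasurableSpace K] [BorelSpace K] {μ : Measure K}

theorem continuous_fourierIntegral (he : IsFixedCharacter e) {f : K → ℂ} (hf : Integrable f μ) :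
    Continuous (Fourier.fourierIntegral e μ f) :=
  VectorFourier.fourierIntegral_continuous he.continuous (by simpa using continuous_mul) hf

variable [μ.IsAddHaarMeasure]

theorem setIntegral_character (hμ : μ {x : K | valuation K x ≤ 1} = 1)
    (he : IsFixedCharacter e) {r : K} (hr : r ≠ 0) (t : K) :
    ∫ ξ in {ξ : K | valuation K ξ ≤ valuation K r}, (e (-(t * ξ)) : ℂ) ∂μ =
      if valuation K (t * r) ≤ 1 then (absVal r : ℂ) else 0 := by
  have hV := measurableSet_valuation_le (valuation K r)
  have hVr := measure_valuation_le hμ hr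
  split_ifs with h
  · have htrivial : ∀ ξ ∈ {ξ : K | valuation K ξ ≤ valuation K r}, (e (-(t * ξ)) : ℂ) = 1 := by
      intro ξ hξ
      rw [map_mul] at h
      rw [he.trivial_on_integers _ (by
        rw [Valuation.map_neg, map_mul]; exact (mul_le_mul_right hξ _).trans h), Circle.coe_one]
    rw [setIntegral_congr_fun hV htrivial]
    simp [Measure.real, hVr, eAbs, absVal_nonneg]
  · obtain ⟨x, hx, hex⟩ := he.exists_valuation_le (not_le.1 h)
    have ht : t ≠ 0 := by rintro rfl; simp at h
    have ht0 : 0 < valuation K t := by simpa [zero_lt_iff] using ht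
    have hmem : valuation K (-(x / t)) ≤ valuation K r := by
      rwa [Valuation.map_neg, map_div₀, div_le_iff₀ ht0, mul_comm, ← map_mul]
    have hzero : ∫ ξ in {ξ : K | valuation K ξ ≤ valuation K r}, (e.mulShift (-t) ξ : ℂ) ∂μ = 0 :=
      setIntegral_addChar_eq_zero (V := (valuation K).leAddSubgroup (valuation K r)) hV hmem (by
        rwa [AddChar.mulShift_apply, neg_mul_neg, mul_div_cancel₀ _ ht])
    simpa only [AddChar.mulShift_apply, neg_mul] using hzero

theorem fourierIntegral_autocorrelation (he : IsFixedCharacter e) {f : K → ℂ}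
    (hf : Integrable f μ) (ξ : K) :
    Fourier.fourierIntegral e μ (autocorrelation μ f) ξ =
      Fourier.fourierIntegral e μ f ξ * conj (Fourier.fourierIntegral e μ f ξ) := by
  have hchar : ∀ y s, (e (-(s * ξ)) : ℂ) = e (-((y + s) * ξ)) * conj (e (-(y * ξ)) : ℂ) := by
    intro y s
    rw [← Circle.coe_inv_eq_conj, ← AddChar.map_neg_eq_inv, ← Circle.coe_mul, ← e.map_add_eq_mul]
    congr 2; ring
  have hint : Integrable (fun p : K × K => (e (-(p.2 * ξ)) : ℂ) * (f (p.1 + p.2) * conj (f p.1)))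
      (μ.prod μ) :=
    (integrable_mul_conj_add hf).bdd_mul (c := 1)
      ((continuous_subtype_val.comp (he.continuous.comp (by fun_prop))).aestronglyMeasurable)
      (ae_of_all _ fun p => (Circle.norm_coe _).le)
  have htranslate : ∀ y, ∫ s, (e (-((y + s) * ξ)) : ℂ) * f (y + s) ∂μ =
      Fourier.fourierIntegral e μ f ξ := fun y => by
    rw [fourierIntegral_apply, integral_add_left_eq_self fun x => (e (-(x * ξ)) : ℂ) * f x]
  calc Fourier.fourierIntegral e μ (autocorrelation μ f) ξ
      = ∫ s, ∫ y, (e (-(s * ξ)) : ℂ) * (f (y + s) * conj (f y)) ∂μ ∂μ := by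
        simp only [fourierIntegral_apply, autocorrelation, integral_const_mul]
    _ = ∫ y, ∫ s, (e (-(s * ξ)) : ℂ) * (f (y + s) * conj (f y)) ∂μ ∂μ :=
        (integral_integral_swap hint).symm
    _ = ∫ y, Fourier.fourierIntegral e μ f ξ * conj ((e (-(y * ξ)) : ℂ) * f y) ∂μ := by
        congr with y
        rw [← htranslate y, ← integral_mul_const]
        congr with s
        rw [hchar y s, map_mul]
        ring
    _ = _ := by rw [integral_const_mul, integral_conj, ← fourierIntegral_apply]

theorem setIntegral_fourierIntegral (hμ : μ {x : K | valuation K x ≤ 1} = 1)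
    (he : IsFixedCharacter e) {A : K → ℂ} (hA : Integrable A μ) {r : K} (hr : r ≠ 0) :
    ∫ ξ in {ξ : K | valuation K ξ ≤ valuation K r}, Fourier.fourierIntegral e μ A ξ ∂μ =
      (absVal r : ℂ) * ∫ s in {s : K | valuation K s ≤ valuation K r⁻¹}, A s ∂μ := by
  set V := {ξ : K | valuation K ξ ≤ valuation K r} with hV
  have hVfin : IsFiniteMeasure (μ.restrict V) :=
    ⟨by rw [Measure.restrict_apply_univ, hV, measure_valuation_le hμ hr]
        exact (eAbs_ne_top r).lt_top⟩
  have hint : Integrable (fun p : K × K => (e (-(p.2 * p.1)) : ℂ) * A p.2)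
      ((μ.restrict V).prod μ) :=
    (hA.comp_snd _).bdd_mul (c := 1)
      (continuous_subtype_val.comp (he.continuous.comp (by fun_prop))).aestronglyMeasurable
      (ae_of_all _ fun p => (Circle.norm_coe _).le)
  have hiff : ∀ s : K, valuation K (s * r) ≤ 1 ↔ valuation K s ≤ valuation K r⁻¹ := fun s => by
    rw [map_mul, map_inv₀, ← one_div, le_div_iff₀ (by simpa [zero_lt_iff] using hr)]
  simp only [fourierIntegral_apply]
  rw [integral_integral_swap hint, ← integral_indicator (measurableSet_valuation_le _),
    ← integral_const_mul]
  congr with s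
  rw [integral_mul_const, setIntegral_character hμ he hr]
  simp only [hiff, Set.indicator_apply, Set.mem_ofPred_eq, ite_mul, mul_ite, zero_mul, mul_zero]

theorem tendsto_setIntegral_fourierIntegral (hμ : μ {x : K | valuation K x ≤ 1} = 1)
    (he : IsFixedCharacter e) {A : K → ℂ} (hA : Integrable A μ) (hA0 : ContinuousAt A 0) {ϖ : K}
    (h0 : ϖ ≠ 0) (h1 : valuation K ϖ < 1) :
    Tendsto (fun n : ℕ => ∫ ξ in {ξ : K | valuation K ξ ≤ valuation K (ϖ ^ n)⁻¹},
      Fourier.fourierIntegral e μ A ξ ∂μ) atTop (𝓝 (A 0)) := by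
  have hpow := fun n : ℕ => pow_ne_zero n h0
  have hshrink : Tendsto (fun n : ℕ => {s : K | valuation K s ≤ valuation K (ϖ ^ n)}) atTop
      (𝓝 (0 : K)).smallSets := by
    refine (IsValuativeTopology.hasBasis_nhds_zero' K).smallSets.tendsto_right_iff.2 fun γ hγ => ?_
    obtain ⟨n, hn⟩ := exists_valuation_pow_lt h1 hγ
    filter_upwards [eventually_ge_atTop n] with m hm x hx
    exact (le_trans hx (antitone_valuation_pow h1 hm)).trans_lt hn
  have hlittleO := hA0.integral_sub_linear_isLittleO_ae
    (hA.1.stronglyMeasurableAtFilter (l := 𝓝 0)) hshrink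
  have hmeasure : ∀ n : ℕ, μ.real {s : K | valuation K s ≤ valuation K (ϖ ^ n)} =
      absVal (ϖ ^ n) := fun n => by
    rw [Measure.real, measure_valuation_le hμ (hpow n), eAbs,
      ENNReal.toReal_ofReal (absVal_nonneg _)]
  simp only [hmeasure] at hlittleO
  refine tendsto_sub_nhds_zero_iff.1 ((hlittleO.tendsto_inv_smul_nhds_zero).congr fun n => ?_)
  rw [setIntegral_fourierIntegral hμ he hA (inv_ne_zero (hpow n)), inv_inv, smul_sub, smul_smul,
    inv_mul_cancel₀ (absVal_pos (hpow n)).ne', one_smul, absVal_inv, Complex.real_smul]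

theorem lintegral_enorm_fourierIntegral_sq (hμ : μ {x : K | valuation K x ≤ 1} = 1)
    (he : IsFixedCharacter e) {f : K → ℂ} (hf : Integrable f μ) (hf2 : MemLp f 2 μ) :
    ∫⁻ ξ, ‖Fourier.fourierIntegral e μ f ξ‖ₑ ^ 2 ∂μ = ∫⁻ x, ‖f x‖ₑ ^ 2 ∂μ := by
  obtain ⟨ϖ, h0, h1⟩ := exists_valuation_lt_one K
  set F := Fourier.fourierIntegral e μ f
  have hFc : Continuous F := continuous_fourierIntegral he hf
  have hballs : ∀ n : ℕ, MemLp F 2 (μ.restrict {ξ | valuation K ξ ≤ valuation K (ϖ ^ n)⁻¹}) :=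
    fun n => by
      refine (memLp_two_iff_integrable_sq_norm hFc.aestronglyMeasurable).2 ?_
      exact (hFc.norm.pow 2).continuousOn.integrableOn_compact
        (IsNonarchimedeanLocalField.isCompact_closedBall K _)
  refine tendsto_nhds_unique ((aecover_valuation_le_inv_pow μ h0 h1).lintegral_tendsto_of_nat
    (f := fun ξ => ‖F ξ‖ₑ ^ 2) (hFc.enorm.measurable.pow_const 2).aemeasurable) ?_
  have hlim := tendsto_setIntegral_fourierIntegral hμ he (integrable_autocorrelation hf)
    (continuousAt_autocorrelation hf2) h0 h1
  simp only [fourierIntegral_autocorrelation he hf, integral_mul_conj_self,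
    autocorrelation_zero] at hlim
  have hreal := ENNReal.tendsto_ofReal ((Complex.continuous_re.tendsto _).comp hlim)
  simp only [Function.comp_def, Complex.ofReal_re, ofReal_integral_norm_sq hf2] at hreal
  exact hreal.congr fun n => ofReal_integral_norm_sq (hballs n)

end Plancherel

section L2Fourier

variable {K : Type*} [Field K] [ValuativeRel K] [TopologicalSpace K]
  [IsNonarchimedeanLocalField K] [MeasurableSpace K] [BorelSpace K] {μ : Measure K}
  {e : AddChar K Circle}

theorem fourierIntegral_add_const_smul (he : IsFixedCharacter e) {f g : K → ℂ}
    (hf : Integrable f μ) (hg : Integrable g μ) (c : ℂ) :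
    Fourier.fourierIntegral e μ (f + c • g) =
      Fourier.fourierIntegral e μ f + c • Fourier.fourierIntegral e μ g :=
  (VectorFourier.fourierIntegral_add he.continuous (L := LinearMap.mul K K)
    (by simpa using continuous_mul) hf (hg.smul c)).trans
    (congrArg _ (VectorFourier.fourierIntegral_const_smul _ _ _ _ _))

variable [μ.IsAddHaarMeasure]

theorem eLpNorm_fourierIntegral (hμ : μ {x : K | valuation K x ≤ 1} = 1)
    (he : IsFixedCharacter e) {f : K → ℂ} (hf : MemLp f 1 μ) (hf2 : MemLp f 2 μ) :
    eLpNorm (Fourier.fourierIntegral e μ f) 2 μ = eLpNorm f 2 μ := by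
  refine (ENNReal.pow_right_strictMono two_ne_zero).injective ?_
  simpa only [eLpNorm_two_sq] using
    lintegral_enorm_fourierIntegral_sq hμ he (memLp_one_iff_integrable.1 hf) hf2

theorem memLp_fourierIntegral (hμ : μ {x : K | valuation K x ≤ 1} = 1)
    (he : IsFixedCharacter e) {f : K → ℂ} (hf : MemLp f 1 μ) (hf2 : MemLp f 2 μ) :
    MemLp (Fourier.fourierIntegral e μ f) 2 μ :=
  ⟨(continuous_fourierIntegral he (memLp_one_iff_integrable.1 hf)).aestronglyMeasurable,
    (eLpNorm_fourierIntegral hμ he hf hf2).trans_lt hf2.2⟩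

theorem norm_toLp_fourierIntegral_add_smul (hμ : μ {x : K | valuation K x ≤ 1} = 1)
    (he : IsFixedCharacter e) {f g : K → ℂ} (hf : MemLp f 1 μ) (hf2 : MemLp f 2 μ)
    (hg : MemLp g 1 μ) (hg2 : MemLp g 2 μ) (c : ℂ) :
    ‖(memLp_fourierIntegral hμ he hf hf2).toLp _ + c • (memLp_fourierIntegral hμ he hg hg2).toLp _‖
      = ‖hf2.toLp f + c • hg2.toLp g‖ := by
  rw [← MemLp.toLp_const_smul, ← MemLp.toLp_const_smul, ← MemLp.toLp_add, ← MemLp.toLp_add,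
    Lp.norm_toLp, Lp.norm_toLp, ← fourierIntegral_add_const_smul he
      (memLp_one_iff_integrable.1 hf) (memLp_one_iff_integrable.1 hg),
    eLpNorm_fourierIntegral hμ he (hf.add (hg.const_smul c)) (hf2.add (hg2.const_smul c))]

theorem inner_toLp_fourierIntegral (hμ : μ {x : K | valuation K x ≤ 1} = 1)
    (he : IsFixedCharacter e) {f g : K → ℂ} (hf : MemLp f 1 μ) (hf2 : MemLp f 2 μ)
    (hg : MemLp g 1 μ) (hg2 : MemLp g 2 μ) :
    inner ℂ ((memLp_fourierIntegral hμ he hf hf2).toLp _)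
      ((memLp_fourierIntegral hμ he hg hg2).toLp _) = inner ℂ (hf2.toLp f) (hg2.toLp g) := by
  simpa using inner_eq_mul_inner_of_norm_sq_eq (k := 1) fun c => by
    rw [one_mul, norm_toLp_fourierIntegral_add_smul hμ he hf hf2 hg hg2]

theorem IsL2Fourier.integral_mul_conj (hμ : μ {x : K | valuation K x ≤ 1} = 1)
    (he : IsFixedCharacter e) {f F g G : K → ℂ} (hf : IsL2Fourier e μ f F)
    (hg : IsL2Fourier e μ g G) : ∫ x, f x * conj (g x) ∂μ = ∫ ξ, F ξ * conj (G ξ) ∂μ := by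
  obtain ⟨hf2, hF2, u, hu, huf, huF⟩ := hf
  obtain ⟨hg2, hG2, v, hv, hvg, hvG⟩ := hg
  have hu_fourier := fun n => memLp_fourierIntegral hμ he (hu n).1 (hu n).2
  have hv_fourier := fun n => memLp_fourierIntegral hμ he (hv n).1 (hv n).2
  have hlim := Tendsto.inner (𝕜 := ℂ)
    ((Lp.tendsto_Lp_iff_tendsto_eLpNorm'' v (fun n => (hv n).2) g hg2).2 hvg)
    ((Lp.tendsto_Lp_iff_tendsto_eLpNorm'' u (fun n => (hu n).2) f hf2).2 huf)
  have hlim_fourier := Tendsto.inner (𝕜 := ℂ)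
    ((Lp.tendsto_Lp_iff_tendsto_eLpNorm'' _ hv_fourier G hG2).2 hvG)
    ((Lp.tendsto_Lp_iff_tendsto_eLpNorm'' _ hu_fourier F hF2).2 huF)
  rw [← inner_toLp hf2 hg2, ← inner_toLp hF2 hG2]
  exact tendsto_nhds_unique hlim (hlim_fourier.congr fun n =>
    inner_toLp_fourierIntegral hμ he (hv n).1 (hv n).2 (hu n).1 (hu n).2)

theorem IsL2Fourier.lintegral_enorm_sq (hμ : μ {x : K | valuation K x ≤ 1} = 1)
    (he : IsFixedCharacter e) {f F : K → ℂ} (hf : IsL2Fourier e μ f F) :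
    ∫⁻ ξ, ‖F ξ‖ₑ ^ 2 ∂μ = ∫⁻ x, ‖f x‖ₑ ^ 2 ∂μ := by
  have hparseval := hf.integral_mul_conj hμ he hf
  rw [integral_mul_conj_self, integral_mul_conj_self, Complex.ofReal_inj] at hparseval
  rw [← ofReal_integral_norm_sq hf.1, ← ofReal_integral_norm_sq hf.2.1, hparseval]

theorem exists_isL2Fourier (hμ : μ {x : K | valuation K x ≤ 1} = 1)
    (he : IsFixedCharacter e) {f : K → ℂ} (hf : MemLp f 2 μ) : ∃ F, IsL2Fourier e μ f F := by
  obtain ⟨u, hu, huf⟩ := exists_integrable_approx hf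
  have hu_fourier := fun n => memLp_fourierIntegral hμ he (hu n).1 (hu n).2
  have hdist : ∀ m n, dist ((hu_fourier m).toLp _) ((hu_fourier n).toLp _) =
      dist ((hu m).2.toLp _) ((hu n).2.toLp _) := fun m n => by
    simpa only [neg_smul, one_smul, ← sub_eq_add_neg, ← dist_eq_norm] using
      norm_toLp_fourierIntegral_add_smul hμ he (hu m).1 (hu m).2 (hu n).1 (hu n).2 (-1)
  have hcauchy : CauchySeq fun n => (hu_fourier n).toLp _ := by
    have := ((Lp.tendsto_Lp_iff_tendsto_eLpNorm'' u (fun n => (hu n).2) f hf).2 huf).cauchySeq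
    simpa only [Metric.cauchySeq_iff, hdist] using this
  obtain ⟨F, hF⟩ := cauchySeq_tendsto_of_complete hcauchy
  refine ⟨F, hf, Lp.memLp F, u, hu, huf, ?_⟩
  rwa [← Lp.tendsto_Lp_iff_tendsto_eLpNorm'' _ hu_fourier _ (Lp.memLp F), Lp.toLp_coeFn]

theorem isL2Fourier_l2Fourier (hμ : μ {x : K | valuation K x ≤ 1} = 1)
    (he : IsFixedCharacter e) {f : K → ℂ} (hf : MemLp f 2 μ) :
    IsL2Fourier e μ f (l2Fourier e μ f) := by
  have h := exists_isL2Fourier hμ he hf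
  rw [l2Fourier, dif_pos h]
  exact h.choose_spec

end L2Fourier

section DaughterWavelets

variable {K : Type*} [Field K] [ValuativeRel K] [TopologicalSpace K]
  [IsNonarchimedeanLocalField K]

theorem daughter_sub (ψ φ : K → ℂ) (a b : K) :
    daughter (ψ - φ) a b = daughter ψ a b - daughter φ a b := by
  ext x
  simp only [daughter, Pi.sub_apply, mul_sub]

theorem enorm_daughter_sq (ψ : K → ℂ) {a : K} (ha : a ≠ 0) (b x : K) :
    ‖daughter ψ a b x‖ₑ ^ 2 = (eAbs a)⁻¹ * ‖ψ ((x - b) / a)‖ₑ ^ 2 := by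
  have hpos := absVal_pos ha
  rw [daughter, enorm_mul, mul_pow, ← ofReal_norm, Complex.norm_real,
    Real.norm_of_nonneg (by positivity), ← ENNReal.ofReal_pow (by positivity), div_pow,
    Real.sq_sqrt hpos.le, one_pow, one_div, ENNReal.ofReal_inv_of_pos hpos, eAbs]

variable [MeasurableSpace K] [BorelSpace K]

theorem measurableEmbedding_affine {a : K} (ha : a ≠ 0) (b : K) :
    MeasurableEmbedding (fun x : K => (x - b) / a) := by
  simp only [div_eq_mul_inv]
  exact ((MeasurableEquiv.subRight b).trans
    (MeasurableEquiv.mulRight₀ a⁻¹ (inv_ne_zero ha))).measurableEmbedding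

variable {μ : Measure K} [μ.IsAddHaarMeasure]

theorem map_affine {a : K} (ha : a ≠ 0) (b : K) :
    μ.map (fun x => (x - b) / a) = eAbs a • μ := by
  have hcomp : (fun x : K => (x - b) / a) = (fun x => a⁻¹ * x) ∘ fun x => x + -b := by
    ext x
    simp only [Function.comp_apply, div_eq_inv_mul, sub_eq_add_neg]
  rw [hcomp, ← Measure.map_map (measurable_const_mul _) (measurable_add_const _),
    map_add_right_eq_self, map_mul_left μ (inv_ne_zero ha), eAbs_inv ha, inv_inv]

theorem quasiMeasurePreserving_affine {a : K} (ha : a ≠ 0) (b : K) :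
    Measure.QuasiMeasurePreserving (fun x => (x - b) / a) μ μ :=
  ⟨(measurableEmbedding_affine ha b).measurable, by
    rw [map_affine ha]; exact Measure.smul_absolutelyContinuous⟩

theorem lintegral_comp_mul_left {α : K} (hα : α ≠ 0) (f : K → ℝ≥0∞) :
    ∫⁻ x, f (α * x) ∂μ = (eAbs α)⁻¹ * ∫⁻ x, f x ∂μ := by
  rw [← smul_eq_mul, ← lintegral_smul_measure, ← map_mul_left μ hα,
    (measurableEmbedding_mulLeft₀ hα).lintegral_map]

theorem aestronglyMeasurable_daughter {Y : Type*} [MeasurableSpace Y] {ν : Measure Y}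
    (hμ : μ {x : K | valuation K x ≤ 1} = 1) {ψ : K → ℂ} (hψ : AEStronglyMeasurable ψ μ)
    {α β : Y → K} (hα : Measurable α) (hβ : Measurable β) (hα0 : ∀ᵐ y ∂ν, α y ≠ 0) :
    AEStronglyMeasurable (fun p : Y × K => daughter ψ (α p.1) (β p.1) p.2) (ν.prod μ) := by
  have hquasi : Measure.QuasiMeasurePreserving (fun p : Y × K => (p.2 - β p.1) / α p.1)
      (ν.prod μ) μ :=
    QuasiMeasurePreserving.prod_of_right (by fun_prop)
      (hα0.mono fun y hy => quasiMeasurePreserving_affine hy (β y))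
  have hscale : Measurable fun p : Y × K => ((1 / √(absVal (α p.1)) : ℝ) : ℂ) := by
    have := measurable_absVal hμ
    fun_prop
  exact hscale.aestronglyMeasurable.mul (hψ.comp_quasiMeasurePreserving hquasi)

theorem eLpNorm_daughter (ψ : K → ℂ) {a : K} (ha : a ≠ 0) (b : K) :
    eLpNorm (daughter ψ a b) 2 μ = eLpNorm ψ 2 μ := by
  refine (ENNReal.pow_right_strictMono two_ne_zero).injective ?_
  simp only [eLpNorm_two_sq, enorm_daughter_sq ψ ha]
  rw [lintegral_const_mul' _ _ (ENNReal.inv_ne_top.2 (eAbs_ne_zero ha)),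
    ← (measurableEmbedding_affine ha b).lintegral_map (fun y => ‖ψ y‖ₑ ^ 2), map_affine ha,
    lintegral_smul_measure, smul_eq_mul,
    ENNReal.inv_mul_cancel_left (eAbs_ne_zero ha) (eAbs_ne_top a)]

theorem memLp_daughter {ψ : K → ℂ} {p : ℝ≥0∞} (hψ : MemLp ψ p μ) {a : K} (ha : a ≠ 0) (b : K) :
    MemLp (daughter ψ a b) p μ := by
  have hmap : MemLp ψ p (μ.map fun x => (x - b) / a) := by
    rw [map_affine ha]
    exact hψ.smul_measure (eAbs_ne_top a)
  exact ((measurableEmbedding_affine ha b).memLp_map_measure_iff.1 hmap).const_mul _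

/-- The Fourier transform of the daughter wavelet `ψ_{a,b}`, written in terms of the Fourier
transform `Ψ` of `ψ`: the character `ξ ↦ e(-b ξ)` times the dilate of `Ψ` by `a⁻¹`. -/
noncomputable def fourierDaughter (e : AddChar K Circle) (Ψ : K → ℂ) (a b ξ : K) : ℂ :=
  (e (-(b * ξ)) : ℂ) * daughter Ψ a⁻¹ 0 ξ

variable {e : AddChar K Circle}

theorem fourierIntegral_daughter (ψ : K → ℂ) {a : K} (ha : a ≠ 0) (b : K) :
    Fourier.fourierIntegral e μ (daughter ψ a b) =
      fourierDaughter e (Fourier.fourierIntegral e μ ψ) a b := by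
  ext ξ
  have hchar : ∀ x, (e (-(x * ξ)) : ℂ) = e (-(b * ξ)) * e (-((x - b) / a * (a * ξ))) := fun x => by
    rw [← Circle.coe_mul, ← e.map_add_eq_mul]
    congr 2
    field_simp
    ring
  have hpos := absVal_pos ha
  have hsqrt : ((1 / √(absVal a) : ℝ) : ℂ) * (absVal a : ℂ) = ((1 / √(absVal a⁻¹) : ℝ) : ℂ) := by
    rw [← Complex.ofReal_mul, one_div, inv_mul_eq_div, Real.div_sqrt, absVal_inv, Real.sqrt_inv,
      one_div, inv_inv]
  calc Fourier.fourierIntegral e μ (daughter ψ a b) ξ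
      = ∫ x, ((1 / √(absVal a) : ℝ) : ℂ) * (e (-(b * ξ)) : ℂ) *
          (fun y => (e (-(y * (a * ξ))) : ℂ) * ψ y) ((x - b) / a) ∂μ := by
        rw [fourierIntegral_apply]
        congr with x
        rw [hchar, daughter]
        ring
    _ = ((1 / √(absVal a) : ℝ) : ℂ) * (e (-(b * ξ)) : ℂ) *
          ((absVal a : ℂ) * Fourier.fourierIntegral e μ ψ (a * ξ)) := by
        rw [integral_const_mul, ← (measurableEmbedding_affine ha b).integral_map
          (fun y => (e (-(y * (a * ξ))) : ℂ) * ψ y), map_affine ha, integral_smul_measure,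
          fourierIntegral_apply, eAbs, ENNReal.toReal_ofReal hpos.le, Complex.real_smul]
    _ = fourierDaughter e (Fourier.fourierIntegral e μ ψ) a b ξ := by
        rw [fourierDaughter, daughter, ← hsqrt, sub_zero, div_inv_eq_mul, mul_comm ξ a]
        ring

theorem eLpNorm_fourierDaughter (Ψ : K → ℂ) {a : K} (ha : a ≠ 0) (b : K) :
    eLpNorm (fourierDaughter e Ψ a b) 2 μ = eLpNorm Ψ 2 μ := by
  rw [← eLpNorm_daughter Ψ (inv_ne_zero ha) 0]
  refine eLpNorm_congr_norm_ae (ae_of_all _ fun ξ => ?_)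
  rw [fourierDaughter, norm_mul, Circle.norm_coe, one_mul]

theorem isL2Fourier_daughter (he : IsFixedCharacter e) {ψ Ψ : K → ℂ} (h : IsL2Fourier e μ ψ Ψ)
    {a : K} (ha : a ≠ 0) (b : K) :
    IsL2Fourier e μ (daughter ψ a b) (fourierDaughter e Ψ a b) := by
  obtain ⟨hψ, hΨ, u, hu, huψ, huΨ⟩ := h
  have hmeas : AEStronglyMeasurable (fourierDaughter e Ψ a b) μ :=
    (continuous_subtype_val.comp (he.continuous.comp (by fun_prop))).aestronglyMeasurable.mul
      (memLp_daughter hΨ (inv_ne_zero ha) 0).1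
  refine ⟨memLp_daughter hψ ha b, ⟨hmeas, (eLpNorm_fourierDaughter Ψ ha b).trans_lt hΨ.2⟩,
    fun n => daughter (u n) a b,
    fun n => ⟨memLp_daughter (hu n).1 ha b, memLp_daughter (hu n).2 ha b⟩, ?_, ?_⟩
  · simpa only [← daughter_sub, eLpNorm_daughter _ ha] using huψ
  · have hsub : ∀ n, Fourier.fourierIntegral e μ (daughter (u n) a b) - fourierDaughter e Ψ a b =
        fourierDaughter e (Fourier.fourierIntegral e μ (u n) - Ψ) a b := fun n => by
      rw [fourierIntegral_daughter _ ha]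
      ext ξ
      simp only [fourierDaughter, daughter_sub, Pi.sub_apply, mul_sub]
    simpa only [hsub, eLpNorm_fourierDaughter _ ha] using huΨ

end DaughterWavelets

section WaveletTransform

variable {K : Type*} [Field K] [ValuativeRel K] [TopologicalSpace K]
  [IsNonarchimedeanLocalField K] [MeasurableSpace K] {μ : Measure K}

theorem cwt_const_smul (ψ f : K → ℂ) (c : ℂ) (a b : K) :
    cwt μ ψ (c • f) a b = c * cwt μ ψ f a b := by
  simp only [cwt, Pi.smul_apply, smul_eq_mul, mul_assoc, integral_const_mul]

theorem cwt_congr {ψ f g : K → ℂ} (h : f =ᵐ[μ] g) (a b : K) :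
    cwt μ ψ f a b = cwt μ ψ g a b :=
  integral_congr_ae (h.mono fun x hx => by simp only [hx])

/-- The measure `|a|⁻² da db` on `K × K`, for which the wavelet transform of an admissible wavelet
is an isometry up to a constant: the left Haar measure of the affine group. -/
noncomputable def affineMeasure (μ : Measure K) : Measure (K × K) :=
  (μ.withDensity fun a => (eAbs a)⁻¹ ^ 2).prod μ

variable [BorelSpace K] [μ.IsAddHaarMeasure]

instance : SFinite (affineMeasure μ) := by unfold affineMeasure; infer_instance

theorem lintegral_affineMeasure (hμ : μ {x : K | valuation K x ≤ 1} = 1) {f : K × K → ℝ≥0∞}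
    (hf : AEMeasurable f (affineMeasure μ)) :
    ∫⁻ q, f q ∂(affineMeasure μ) = ∫⁻ a, (eAbs a)⁻¹ ^ 2 * ∫⁻ b, f (a, b) ∂μ ∂μ := by
  have hdensity : Measurable fun a : K => (eAbs a)⁻¹ ^ 2 :=
    (measurable_absVal hμ).ennreal_ofReal.inv.pow_const 2
  rw [affineMeasure, lintegral_prod _ hf,
    lintegral_withDensity_eq_lintegral_mul₀' hdensity.aemeasurable hf.lintegral_prod_right']
  rfl

theorem ae_affineMeasure_ne_zero : ∀ᵐ q ∂(affineMeasure μ), q.1 ≠ 0 :=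
  Measure.quasiMeasurePreserving_fst.ae
    ((withDensity_absolutelyContinuous μ _).ae_le (Measure.ae_ne μ 0))

theorem aestronglyMeasurable_cwt (hμ : μ {x : K | valuation K x ≤ 1} = 1) {ψ f : K → ℂ}
    (hψ : AEStronglyMeasurable ψ μ) (hf : AEStronglyMeasurable f μ) :
    AEStronglyMeasurable (fun q : K × K => cwt μ ψ f q.1 q.2) (affineMeasure μ) :=
  (hf.comp_snd.mul (Complex.continuous_conj.comp_aestronglyMeasurable
    (aestronglyMeasurable_daughter hμ hψ measurable_fst measurable_snd
      ae_affineMeasure_ne_zero))).integral_prod_right'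

theorem norm_cwt_le {ψ f : K → ℂ} (hψ : MemLp ψ 2 μ) (hf : MemLp f 2 μ) {a : K} (ha : a ≠ 0)
    (b : K) : ‖cwt μ ψ f a b‖ ≤ (eLpNorm f 2 μ).toReal * (eLpNorm ψ 2 μ).toReal := by
  refine (norm_integral_mul_le hf (memLp_conj (memLp_daughter hψ ha b))).trans_eq ?_
  rw [← eLpNorm_daughter ψ ha b]
  congr 2
  exact eLpNorm_congr_norm_ae (ae_of_all _ fun x => RCLike.norm_conj _)

theorem cwt_add {ψ f g : K → ℂ} (hψ : MemLp ψ 2 μ) (hf : MemLp f 2 μ) (hg : MemLp g 2 μ) {a : K}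
    (ha : a ≠ 0) (b : K) : cwt μ ψ (f + g) a b = cwt μ ψ f a b + cwt μ ψ g a b := by
  have hconj := memLp_conj (memLp_daughter hψ ha b)
  simp only [cwt, Pi.add_apply, add_mul]
  exact integral_add (hf.integrable_mul hconj) (hg.integrable_mul hconj)

theorem cwt_sub {ψ f g : K → ℂ} (hψ : MemLp ψ 2 μ) (hf : MemLp f 2 μ) (hg : MemLp g 2 μ) {a : K}
    (ha : a ≠ 0) (b : K) : cwt μ ψ (f - g) a b = cwt μ ψ f a b - cwt μ ψ g a b := by
  rw [eq_sub_iff_add_eq, ← cwt_add hψ (hf.sub hg) hg ha, sub_add_cancel]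

variable {e : AddChar K Circle}

/- For fixed `a`, the transform is in `b` the Fourier transform of `ξ ↦ ψ̂_{a,0}(ξ) conj(f̂(ξ))`,
up to complex conjugation. -/
theorem enorm_cwt_eq_enorm_fourierIntegral (hμ : μ {x : K | valuation K x ≤ 1} = 1)
    (he : IsFixedCharacter e) {ψ Ψ f F : K → ℂ} (hψ : IsL2Fourier e μ ψ Ψ)
    (hf : IsL2Fourier e μ f F) {a : K} (ha : a ≠ 0) (b : K) :
    ‖cwt μ ψ f a b‖ₑ =
      ‖Fourier.fourierIntegral e μ (fun ξ => daughter Ψ a⁻¹ 0 ξ * conj (F ξ)) b‖ₑ := by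
  have hparseval : cwt μ ψ f a b = ∫ ξ, F ξ * conj (fourierDaughter e Ψ a b ξ) ∂μ :=
    hf.integral_mul_conj hμ he (isL2Fourier_daughter he hψ ha b)
  have hconj : conj (cwt μ ψ f a b) =
      Fourier.fourierIntegral e μ (fun ξ => daughter Ψ a⁻¹ 0 ξ * conj (F ξ)) b := by
    rw [hparseval, ← integral_conj, fourierIntegral_apply]
    congr with ξ
    simp only [map_mul, Complex.conj_conj, fourierDaughter, mul_comm b ξ]
    ring
  rw [← hconj, RCLike.enorm_conj]

theorem lintegral_enorm_cwt_sq_right (hμ : μ {x : K | valuation K x ≤ 1} = 1)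
    (he : IsFixedCharacter e) {ψ Ψ f F : K → ℂ} (hψ : IsL2Fourier e μ ψ Ψ)
    (hf : IsL2Fourier e μ f F) {a : K} (ha : a ≠ 0)
    (hfin : ∫⁻ ξ, ‖daughter Ψ a⁻¹ 0 ξ‖ₑ ^ 2 * ‖F ξ‖ₑ ^ 2 ∂μ ≠ ∞) :
    ∫⁻ b, ‖cwt μ ψ f a b‖ₑ ^ 2 ∂μ = ∫⁻ ξ, ‖daughter Ψ a⁻¹ 0 ξ‖ₑ ^ 2 * ‖F ξ‖ₑ ^ 2 ∂μ := by
  have hint : Integrable (fun ξ => daughter Ψ a⁻¹ 0 ξ * conj (F ξ)) μ :=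
    (memLp_daughter hψ.2.1 (inv_ne_zero ha) 0).integrable_mul (memLp_conj hf.2.1)
  have hnorm : ∀ ξ, ‖daughter Ψ a⁻¹ 0 ξ * conj (F ξ)‖ₑ ^ 2 =
      ‖daughter Ψ a⁻¹ 0 ξ‖ₑ ^ 2 * ‖F ξ‖ₑ ^ 2 := fun ξ => by
    rw [enorm_mul, RCLike.enorm_conj, mul_pow]
  simp only [enorm_cwt_eq_enorm_fourierIntegral hμ he hψ hf ha, ← hnorm] at hfin ⊢
  exact lintegral_enorm_fourierIntegral_sq hμ he hint (memLp_two_of_lintegral_ne_top hint.1 hfin)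

theorem lintegral_enorm_daughter_inv_sq (Ψ : K → ℂ) {ξ : K} (hξ : ξ ≠ 0) :
    ∫⁻ a, (eAbs a)⁻¹ ^ 2 * ‖daughter Ψ a⁻¹ 0 ξ‖ₑ ^ 2 ∂μ = ∫⁻ t, ‖Ψ t‖ₑ ^ 2 / eAbs t ∂μ := by
  have hdilate : ∀ᵐ a ∂μ, (eAbs a)⁻¹ ^ 2 * ‖daughter Ψ a⁻¹ 0 ξ‖ₑ ^ 2 =
      eAbs ξ * (fun t => ‖Ψ t‖ₑ ^ 2 / eAbs t) (ξ * a) := by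
    filter_upwards [Measure.ae_ne μ 0] with a ha
    have ha0 := eAbs_ne_zero ha
    have hξ0 := eAbs_ne_zero hξ
    rw [enorm_daughter_sq _ (inv_ne_zero ha), eAbs_inv ha, inv_inv, sub_zero, div_inv_eq_mul,
      eAbs_mul, div_eq_mul_inv, ENNReal.mul_inv (.inl hξ0) (.inl (eAbs_ne_top ξ)), sq, mul_assoc,
      ENNReal.inv_mul_cancel_left ha0 (eAbs_ne_top a), mul_left_comm _ (eAbs ξ)⁻¹,
      ENNReal.mul_inv_cancel_left hξ0 (eAbs_ne_top ξ), mul_comm]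
  rw [lintegral_congr_ae hdilate, lintegral_const_mul' _ _ (eAbs_ne_top ξ),
    lintegral_comp_mul_left hξ (fun t => ‖Ψ t‖ₑ ^ 2 / eAbs t),
    ENNReal.mul_inv_cancel_left (eAbs_ne_zero hξ) (eAbs_ne_top ξ)]

theorem aemeasurable_enorm_daughter_inv_sq_mul (hμ : μ {x : K | valuation K x ≤ 1} = 1)
    {Ψ F : K → ℂ} (hΨ : AEStronglyMeasurable Ψ μ) (hF : AEStronglyMeasurable F μ) :
    AEMeasurable (fun p : K × K => ‖daughter Ψ p.1⁻¹ 0 p.2‖ₑ ^ 2 * ‖F p.2‖ₑ ^ 2) (μ.prod μ) :=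
  ((aestronglyMeasurable_daughter hμ hΨ measurable_inv measurable_const
    ((Measure.ae_ne μ 0).mono fun _ => inv_ne_zero)).enorm.pow_const 2).mul
      (hF.enorm.pow_const 2).comp_snd

theorem lintegral_lintegral_enorm_daughter_inv_sq_mul (hμ : μ {x : K | valuation K x ≤ 1} = 1)
    {Ψ F : K → ℂ} (hΨ : AEStronglyMeasurable Ψ μ) (hF : AEStronglyMeasurable F μ) :
    ∫⁻ a, (eAbs a)⁻¹ ^ 2 * ∫⁻ ξ, ‖daughter Ψ a⁻¹ 0 ξ‖ₑ ^ 2 * ‖F ξ‖ₑ ^ 2 ∂μ ∂μ =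
      (∫⁻ t, ‖Ψ t‖ₑ ^ 2 / eAbs t ∂μ) * ∫⁻ ξ, ‖F ξ‖ₑ ^ 2 ∂μ := by
  have hmeas : AEMeasurable (fun p : K × K =>
      (eAbs p.1)⁻¹ ^ 2 * (‖daughter Ψ p.1⁻¹ 0 p.2‖ₑ ^ 2 * ‖F p.2‖ₑ ^ 2)) (μ.prod μ) :=
    ((measurable_absVal hμ).ennreal_ofReal.inv.pow_const 2).aemeasurable.comp_fst.mul
      (aemeasurable_enorm_daughter_inv_sq_mul hμ hΨ hF)
  calc ∫⁻ a, (eAbs a)⁻¹ ^ 2 * ∫⁻ ξ, ‖daughter Ψ a⁻¹ 0 ξ‖ₑ ^ 2 * ‖F ξ‖ₑ ^ 2 ∂μ ∂μ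
      = ∫⁻ a, ∫⁻ ξ, (eAbs a)⁻¹ ^ 2 * (‖daughter Ψ a⁻¹ 0 ξ‖ₑ ^ 2 * ‖F ξ‖ₑ ^ 2) ∂μ ∂μ := by
        refine lintegral_congr_ae ?_
        filter_upwards [Measure.ae_ne μ 0] with a ha
        rw [lintegral_const_mul' _ _
          (ENNReal.pow_ne_top (ENNReal.inv_ne_top.2 (eAbs_ne_zero ha)))]
    _ = ∫⁻ ξ, ∫⁻ a, (eAbs a)⁻¹ ^ 2 * (‖daughter Ψ a⁻¹ 0 ξ‖ₑ ^ 2 * ‖F ξ‖ₑ ^ 2) ∂μ ∂μ :=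
        lintegral_lintegral_swap hmeas
    _ = ∫⁻ ξ, (∫⁻ t, ‖Ψ t‖ₑ ^ 2 / eAbs t ∂μ) * ‖F ξ‖ₑ ^ 2 ∂μ := by
        refine lintegral_congr_ae ?_
        filter_upwards [Measure.ae_ne μ 0] with ξ hξ
        simp only [← mul_assoc]
        rw [lintegral_mul_const' _ _ (ENNReal.pow_ne_top enorm_ne_top),
          lintegral_enorm_daughter_inv_sq Ψ hξ]
    _ = _ := lintegral_const_mul'' _ (hF.enorm.pow_const 2)

theorem lintegral_enorm_cwt_sq (hμ : μ {x : K | valuation K x ≤ 1} = 1) (he : IsFixedCharacter e)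
    {ψ f : K → ℂ} (hψ : IsAdmissibleWavelet e μ ψ) (hf : MemLp f 2 μ) :
    ∫⁻ q, ‖cwt μ ψ f q.1 q.2‖ₑ ^ 2 ∂(affineMeasure μ) =
      admissibilityConstant e μ ψ * ∫⁻ x, ‖f x‖ₑ ^ 2 ∂μ := by
  have hΨ := isL2Fourier_l2Fourier hμ he hψ.1
  obtain ⟨F, hF⟩ := exists_isL2Fourier hμ he hf
  have htotal := lintegral_lintegral_enorm_daughter_inv_sq_mul hμ hΨ.2.1.1 hF.2.1.1
  rw [hF.lintegral_enorm_sq hμ he] at htotal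
  have hfin := ae_lt_top' (((measurable_absVal hμ).ennreal_ofReal.inv.pow_const 2).aemeasurable.mul
    (aemeasurable_enorm_daughter_inv_sq_mul hμ hΨ.2.1.1 hF.2.1.1).lintegral_prod_right')
    (htotal.trans_ne (ENNReal.mul_ne_top hψ.2.ne (lintegral_enorm_sq_ne_top hf)))
  rw [lintegral_affineMeasure hμ ((aestronglyMeasurable_cwt hμ hψ.1.1 hf.1).enorm.pow_const 2)]
  refine (lintegral_congr_ae ?_).trans htotal
  filter_upwards [hfin, Measure.ae_ne μ 0] with a hfin ha
  rw [lintegral_enorm_cwt_sq_right hμ he hΨ hF ha]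
  exact fun htop => hfin.ne (by
    simp only [Pi.mul_apply, htop]
    exact ENNReal.mul_top (pow_ne_zero 2 (ENNReal.inv_ne_zero.2 (eAbs_ne_top a))))

theorem memLp_cwt (hμ : μ {x : K | valuation K x ≤ 1} = 1) (he : IsFixedCharacter e)
    {ψ f : K → ℂ} (hψ : IsAdmissibleWavelet e μ ψ) (hf : MemLp f 2 μ) :
    MemLp (fun q : K × K => cwt μ ψ f q.1 q.2) 2 (affineMeasure μ) := by
  refine memLp_two_of_lintegral_ne_top (aestronglyMeasurable_cwt hμ hψ.1.1 hf.1) ?_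
  rw [lintegral_enorm_cwt_sq hμ he hψ hf]
  exact ENNReal.mul_ne_top hψ.2.ne (lintegral_enorm_sq_ne_top hf)

theorem norm_toLp_cwt_sq (hμ : μ {x : K | valuation K x ≤ 1} = 1) (he : IsFixedCharacter e)
    {ψ f : K → ℂ} (hψ : IsAdmissibleWavelet e μ ψ) (hf : MemLp f 2 μ) :
    ‖(memLp_cwt hμ he hψ hf).toLp _‖ ^ 2 =
      (admissibilityConstant e μ ψ).toReal * ‖hf.toLp f‖ ^ 2 := by
  simp only [Lp.norm_toLp, ← ENNReal.toReal_pow, eLpNorm_two_sq, ← ENNReal.toReal_mul]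
  rw [lintegral_enorm_cwt_sq hμ he hψ hf]

/-- The wavelet transform of an admissible wavelet, as an operator from `L²(K)` to
`L²(|a|⁻² da db)`. -/
noncomputable def cwtLp (hμ : μ {x : K | valuation K x ≤ 1} = 1) (he : IsFixedCharacter e)
    {ψ : K → ℂ} (hψ : IsAdmissibleWavelet e μ ψ) :
    Lp ℂ 2 μ →L[ℂ] Lp ℂ 2 (affineMeasure μ) :=
  LinearMap.mkContinuous
    { toFun := fun f => (memLp_cwt hμ he hψ (Lp.memLp f)).toLp _
      map_add' := fun f g => by
        rw [← MemLp.toLp_add]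
        exact MemLp.toLp_congr _ _ (ae_affineMeasure_ne_zero.mono fun q hq =>
          (cwt_congr (Lp.coeFn_add f g) q.1 q.2).trans
            (cwt_add hψ.1 (Lp.memLp f) (Lp.memLp g) hq q.2))
      map_smul' := fun c f => by
        rw [RingHom.id_apply, ← MemLp.toLp_const_smul]
        exact MemLp.toLp_congr _ _ (ae_of_all _ fun q =>
          (cwt_congr (Lp.coeFn_smul c f) q.1 q.2).trans (cwt_const_smul ψ f c q.1 q.2)) }
    (√(admissibilityConstant e μ ψ).toReal) fun f => by
      refine (sq_le_sq₀ (norm_nonneg _) (by positivity)).1 (le_of_eq ?_)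
      rw [mul_pow, Real.sq_sqrt ENNReal.toReal_nonneg, LinearMap.coe_mk, AddHom.coe_mk,
        norm_toLp_cwt_sq hμ he hψ (Lp.memLp f), Lp.toLp_coeFn]

theorem cwtLp_toLp (hμ : μ {x : K | valuation K x ≤ 1} = 1) (he : IsFixedCharacter e)
    {ψ f : K → ℂ} (hψ : IsAdmissibleWavelet e μ ψ) (hf : MemLp f 2 μ) :
    cwtLp hμ he hψ (hf.toLp f) = (memLp_cwt hμ he hψ hf).toLp _ :=
  MemLp.toLp_congr (memLp_cwt hμ he hψ (Lp.memLp _)) _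
    (ae_of_all _ fun q => cwt_congr hf.coeFn_toLp q.1 q.2)

theorem norm_cwtLp_sq (hμ : μ {x : K | valuation K x ≤ 1} = 1) (he : IsFixedCharacter e)
    {ψ : K → ℂ} (hψ : IsAdmissibleWavelet e μ ψ) (f : Lp ℂ 2 μ) :
    ‖cwtLp hμ he hψ f‖ ^ 2 = (admissibilityConstant e μ ψ).toReal * ‖f‖ ^ 2 := by
  rw [← Lp.toLp_coeFn f (Lp.memLp f), cwtLp_toLp hμ he hψ (Lp.memLp f)]
  exact norm_toLp_cwt_sq hμ he hψ (Lp.memLp f)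

theorem integral_cwt_mul_conj_cwt (hμ : μ {x : K | valuation K x ≤ 1} = 1)
    (he : IsFixedCharacter e) {ψ f g : K → ℂ} (hψ : IsAdmissibleWavelet e μ ψ)
    (hf : MemLp f 2 μ) (hg : MemLp g 2 μ) :
    ∫ q, cwt μ ψ f q.1 q.2 * conj (cwt μ ψ g q.1 q.2) ∂(affineMeasure μ) =
      (admissibilityConstant e μ ψ).toReal * ∫ x, f x * conj (g x) ∂μ := by
  rw [← inner_toLp (memLp_cwt hμ he hψ hf) (memLp_cwt hμ he hψ hg), ← inner_toLp hf hg,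
    ← cwtLp_toLp hμ he hψ hf, ← cwtLp_toLp hμ he hψ hg]
  refine inner_eq_mul_inner_of_norm_sq_eq fun c => ?_
  rw [← map_smul, ← map_add, norm_cwtLp_sq]

end WaveletTransform

section Kernel

variable {K : Type*} [Field K] [ValuativeRel K] [TopologicalSpace K]
  [IsNonarchimedeanLocalField K]

/-- The function `conj ψ_{a,b}(z) conj χ_{a,b}(y)` of `q = (a, b)` and `p = (y, z)`, which is the
kernel of the bilinear map `(h, g) ↦ K_ψ h · K_χ g`. -/
noncomputable def waveletKernel (ψ χ : K → ℂ) (q p : K × K) : ℂ :=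
  conj (daughter ψ q.1 q.2 p.2) * conj (daughter χ q.1 q.2 p.1)

theorem daughter_affine (ψ : K → ℂ) {l : K} (hl : l ≠ 0) (z a b t : K) :
    daughter ψ (l * a) (z + l * b) (z + l * t) = (1 / √(absVal l) : ℝ) * daughter ψ a b t := by
  have harg : (z + l * t - (z + l * b)) / (l * a) = (t - b) / a := by
    rw [add_sub_add_left_eq_sub, ← mul_sub, mul_div_mul_left _ _ hl]
  rw [daughter, daughter, harg, absVal_mul, Real.sqrt_mul (absVal_nonneg l), ← mul_assoc,
    ← Complex.ofReal_mul, one_div_mul_one_div]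

theorem waveletKernel_affine (ψ χ : K → ℂ) {l : K} (hl : l ≠ 0) (z : K) (q p : K × K) :
    waveletKernel ψ χ (l * q.1, z + l * q.2) (z + l * p.1, z + l * p.2) =
      ((absVal l)⁻¹ : ℝ) * waveletKernel ψ χ q p := by
  have hsqrt : (absVal l)⁻¹ = 1 / √(absVal l) * (1 / √(absVal l)) := by
    rw [one_div_mul_one_div, Real.mul_self_sqrt (absVal_nonneg l), one_div]
  simp only [waveletKernel, daughter_affine _ hl, map_mul, Complex.conj_ofReal, hsqrt,
    Complex.ofReal_mul]
  ring

variable [MeasurableSpace K] {μ : Measure K}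

theorem integral_waveletKernel_mul [SFinite μ] (ψ χ h g : K → ℂ) (q : K × K) :
    ∫ p, waveletKernel ψ χ q p * (g p.1 * h p.2) ∂(μ.prod μ) =
      cwt μ ψ h q.1 q.2 * cwt μ χ g q.1 q.2 := by
  rw [mul_comm, cwt, cwt, ← integral_prod_mul]
  refine integral_congr_ae (ae_of_all _ fun p => ?_)
  simp only [waveletKernel]
  ring

variable [BorelSpace K] [μ.IsAddHaarMeasure]

/-- Left translation `(a, b) ↦ (l a, z + l b)` of the affine group. -/
noncomputable def affineTranslation {l : K} (hl : l ≠ 0) (z : K) : K × K ≃ᵐ K × K :=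
  (MeasurableEquiv.mulLeft₀ l hl).prodCongr
    ((MeasurableEquiv.mulLeft₀ l hl).trans (MeasurableEquiv.addLeft z))

theorem map_affineTranslation (hμ : μ {x : K | valuation K x ≤ 1} = 1) {l : K} (hl : l ≠ 0)
    (z : K) : (affineMeasure μ).map (affineTranslation hl z) = affineMeasure μ := by
  refine Measure.ext_of_lintegral _ fun f hf => ?_
  rw [lintegral_map_equiv, lintegral_affineMeasure hμ hf.aemeasurable,
    lintegral_affineMeasure hμ
      (f := fun q => f (affineTranslation hl z q))
      (hf.comp (affineTranslation hl z).measurable).aemeasurable]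
  have hinner : ∀ a, ∫⁻ b, f (affineTranslation hl z (a, b)) ∂μ =
      (eAbs l)⁻¹ * ∫⁻ b, f (l * a, b) ∂μ := fun a => by
    rw [← lintegral_add_left_eq_self (fun b => f (l * a, b)) z, ← lintegral_comp_mul_left hl]
    rfl
  have hscale : ∀ a, (eAbs a)⁻¹ ^ 2 * ((eAbs l)⁻¹ * ∫⁻ b, f (l * a, b) ∂μ) =
      eAbs l * ((eAbs (l * a))⁻¹ ^ 2 * ∫⁻ b, f (l * a, b) ∂μ) := fun a => by
    rw [eAbs_mul, ENNReal.mul_inv (.inl (eAbs_ne_zero hl)) (.inl (eAbs_ne_top l)), mul_pow,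
      pow_two (eAbs l)⁻¹]
    simp only [← mul_assoc, ENNReal.mul_inv_cancel (eAbs_ne_zero hl) (eAbs_ne_top l), one_mul]
    rw [mul_comm ((eAbs a)⁻¹ ^ 2)]
  simp only [hinner, hscale]
  rw [lintegral_const_mul' _ _ (eAbs_ne_top l),
    lintegral_comp_mul_left hl fun a => (eAbs a)⁻¹ ^ 2 * ∫⁻ b, f (a, b) ∂μ, ← mul_assoc,
    ENNReal.mul_inv_cancel (eAbs_ne_zero hl) (eAbs_ne_top l), one_mul]

theorem eLpNorm_waveletKernel (hμ : μ {x : K | valuation K x ≤ 1} = 1) (ψ χ : K → ℂ) {p : K × K}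
    (hp : p.1 ≠ p.2) :
    eLpNorm (fun q => waveletKernel ψ χ q p) 2 (affineMeasure μ) =
      (eAbs (p.1 - p.2))⁻¹ *
        eLpNorm (fun q => waveletKernel ψ χ q (1, 0)) 2 (affineMeasure μ) := by
  have hl : p.1 - p.2 ≠ 0 := sub_ne_zero.2 hp
  have hkernel : (fun q => waveletKernel ψ χ q p) ∘ affineTranslation hl p.2 =
      (((absVal (p.1 - p.2))⁻¹ : ℝ) : ℂ) • fun q => waveletKernel ψ χ q (1, 0) := by
    ext q
    have h := waveletKernel_affine ψ χ hl p.2 q (1, 0)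
    rwa [mul_one, mul_zero, add_sub_cancel, add_zero] at h
  rw [← map_affineTranslation hμ hl p.2,
    (affineTranslation hl p.2).measurableEmbedding.eLpNorm_map_measure, hkernel,
    eLpNorm_const_smul, map_affineTranslation hμ hl p.2, ← ofReal_norm, Complex.norm_real,
    Real.norm_of_nonneg (inv_nonneg.2 (absVal_nonneg _)),
    ENNReal.ofReal_inv_of_pos (absVal_pos hl), eAbs]

theorem aestronglyMeasurable_waveletKernel (hμ : μ {x : K | valuation K x ≤ 1} = 1) {ψ χ : K → ℂ}
    (hψ : AEStronglyMeasurable ψ μ) (hχ : AEStronglyMeasurable χ μ) :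
    AEStronglyMeasurable (fun r : (K × K) × (K × K) => waveletKernel ψ χ r.1 r.2)
      ((affineMeasure μ).prod (μ.prod μ)) := by
  have hid := Measure.QuasiMeasurePreserving.id (affineMeasure μ)
  have hdaughter {f : K → ℂ} (hf : AEStronglyMeasurable f μ) : AEStronglyMeasurable
      (fun r : (K × K) × K => conj (daughter f r.1.1 r.1.2 r.2)) ((affineMeasure μ).prod μ) :=
    Complex.continuous_conj.comp_aestronglyMeasurable
      (aestronglyMeasurable_daughter hμ hf measurable_fst measurable_snd ae_affineMeasure_ne_zero)
  have hz := (hdaughter hψ).comp_quasiMeasurePreserving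
    (QuasiMeasurePreserving.prodMap hid (Measure.quasiMeasurePreserving_snd (μ := μ) (ν := μ)))
  have hy := (hdaughter hχ).comp_quasiMeasurePreserving
    (QuasiMeasurePreserving.prodMap hid (Measure.quasiMeasurePreserving_fst (μ := μ) (ν := μ)))
  exact hz.mul hy

theorem integrable_waveletKernel_mul {ψ χ h g : K → ℂ} (hψ : MemLp ψ 2 μ) (hχ : MemLp χ 2 μ)
    (hh : MemLp h 2 μ) (hg : MemLp g 2 μ) {q : K × K} (hq : q.1 ≠ 0) :
    Integrable (fun p : K × K => waveletKernel ψ χ q p * (g p.1 * h p.2)) (μ.prod μ) := by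
  refine ((hg.integrable_mul (memLp_conj (memLp_daughter hχ hq q.2))).mul_prod
    (hh.integrable_mul (memLp_conj (memLp_daughter hψ hq q.2)))).congr (ae_of_all _ fun p => ?_)
  simp only [waveletKernel, Pi.mul_apply]
  ring

/-- The trilinear form `∫ (K_ψ h)(a,b) (K_χ g)(a,b) H(a,b) |a|⁻² da db`. -/
noncomputable def waveletForm (μ : Measure K) (ψ χ : K → ℂ) (H : K × K → ℂ) (h g : K → ℂ) : ℂ :=
  ∫ q, cwt μ ψ h q.1 q.2 * (cwt μ χ g q.1 q.2 * H q) ∂(affineMeasure μ)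

/-- The function of `p = (y, z)` that represents the form `waveletForm` as a kernel against
`h(z) g(y)`. -/
noncomputable def synthesis (μ : Measure K) (ψ χ : K → ℂ) (H : K × K → ℂ) (p : K × K) : ℂ :=
  ∫ q, waveletKernel ψ χ q p * H q ∂(affineMeasure μ)

theorem eLpNorm_cwt_mul_le {χ g : K → ℂ} (hχ : MemLp χ 2 μ) (hg : MemLp g 2 μ)
    (H : K × K → ℂ) :
    eLpNorm (fun q => cwt μ χ g q.1 q.2 * H q) 2 (affineMeasure μ) ≤
      eLpNorm g 2 μ * eLpNorm χ 2 μ * eLpNorm H 2 (affineMeasure μ) := by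
  have hbound : ∀ᵐ q ∂(affineMeasure μ), ‖cwt μ χ g q.1 q.2 * H q‖ ≤
      (eLpNorm g 2 μ).toReal * (eLpNorm χ 2 μ).toReal * ‖H q‖ :=
    ae_affineMeasure_ne_zero.mono fun q hq => by
      rw [norm_mul]
      exact mul_le_mul_of_nonneg_right (norm_cwt_le hχ hg hq q.2) (norm_nonneg _)
  refine (eLpNorm_le_mul_eLpNorm_of_ae_le_mul hbound 2).trans_eq ?_
  rw [ENNReal.ofReal_mul ENNReal.toReal_nonneg, ENNReal.ofReal_toReal hg.2.ne,
    ENNReal.ofReal_toReal hχ.2.ne]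

theorem memLp_cwt_mul (hμ : μ {x : K | valuation K x ≤ 1} = 1) {χ g : K → ℂ} (hχ : MemLp χ 2 μ)
    (hg : MemLp g 2 μ) {H : K × K → ℂ} (hH : MemLp H 2 (affineMeasure μ)) :
    MemLp (fun q => cwt μ χ g q.1 q.2 * H q) 2 (affineMeasure μ) :=
  ⟨(aestronglyMeasurable_cwt hμ hχ.1 hg.1).mul hH.1, (eLpNorm_cwt_mul_le hχ hg H).trans_lt
    (ENNReal.mul_lt_top (ENNReal.mul_lt_top hg.2 hχ.2) hH.2)⟩

end Kernel

section Modulation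

variable {K : Type*} [Field K] {e : AddChar K Circle}

/-- Multiplication of `h` by the character `x ↦ e (ξ x)`. -/
noncomputable def modulate (e : AddChar K Circle) (ξ : K) (h : K → ℂ) (x : K) : ℂ :=
  e (ξ * x) * h x

theorem modulate_mul_modulate (ξ : K) (h g : K → ℂ) (y z : K) :
    modulate e (-ξ) g y * modulate e ξ h z = e (ξ * (z - y)) * (g y * h z) := by
  have hsplit : e (ξ * (z - y)) = e (-ξ * y) * e (ξ * z) := by
    rw [← e.map_add_eq_mul, mul_sub, neg_mul, neg_add_eq_sub]
  rw [modulate, modulate, hsplit, Circle.coe_mul]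
  ring

theorem norm_modulate (ξ : K) (h : K → ℂ) (x : K) : ‖modulate e ξ h x‖ = ‖h x‖ := by
  rw [modulate, norm_mul, Circle.norm_coe, one_mul]

variable [MeasurableSpace K] {μ : Measure K}

theorem eLpNorm_modulate (ξ : K) (h : K → ℂ) (p : ℝ≥0∞) :
    eLpNorm (modulate e ξ h) p μ = eLpNorm h p μ :=
  eLpNorm_congr_norm_ae (ae_of_all _ (norm_modulate ξ h))

variable [ValuativeRel K] [TopologicalSpace K] [IsNonarchimedeanLocalField K] [BorelSpace K]

theorem memLp_modulate (he : Continuous e) (ξ : K) {h : K → ℂ} {p : ℝ≥0∞} (hh : MemLp h p μ) :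
    MemLp (modulate e ξ h) p μ := by
  have hchar : Continuous fun x => (e (ξ * x) : ℂ) := by fun_prop
  exact ⟨hchar.aestronglyMeasurable.mul hh.1, (eLpNorm_modulate ξ h p).trans_lt hh.2⟩

variable [μ.IsAddHaarMeasure]

theorem enorm_character_sub_one_mul_le (hμ : μ {x : K | valuation K x ≤ 1} = 1)
    (he : IsFixedCharacter e) (ξ t : K) :
    ‖(e (ξ * t) : ℂ) - 1‖ₑ * (eAbs t)⁻¹ ≤ 2 * eAbs ξ := by
  by_cases h : valuation K (ξ * t) ≤ 1
  · rw [he.trivial_on_integers _ h, Circle.coe_one, sub_self, enorm_zero, zero_mul]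
    exact zero_le
  have hone : 1 ≤ absVal ξ * absVal t := by
    rw [← absVal_mul, ← absVal_one (K := K)]
    refine absVal_le_absVal hμ one_ne_zero ?_ (by rw [map_one]; exact (not_le.1 h).le)
    rintro h0
    simp [h0] at h
  have htwo : ‖(e (ξ * t) : ℂ) - 1‖ₑ ≤ 2 := by
    refine enorm_sub_le.trans_eq ?_
    rw [← ofReal_norm, Circle.norm_coe, enorm_one, ENNReal.ofReal_one, one_add_one_eq_two]
  rw [← div_eq_mul_inv]
  refine ENNReal.div_le_of_le_mul (htwo.trans ?_)
  rw [mul_assoc, ← eAbs_mul, eAbs, absVal_mul]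
  exact le_mul_of_one_le_right zero_le (ENNReal.one_le_ofReal.2 hone)

theorem ae_fst_ne_snd : ∀ᵐ p ∂(μ.prod μ), p.1 ≠ p.2 :=
  (Measure.ae_prod_iff_ae_ae (measurableSet_eq_fun measurable_fst measurable_snd).compl).2
    (ae_of_all _ fun y => (Measure.ae_ne μ y).mono fun _ => Ne.symm)

variable {ψ χ : K → ℂ} {H : K × K → ℂ}

theorem ae_lintegral_enorm_waveletKernel_mul_le (hμ : μ {x : K | valuation K x ≤ 1} = 1)
    (hψ : AEStronglyMeasurable ψ μ) (hχ : AEStronglyMeasurable χ μ)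
    (hH : AEStronglyMeasurable H (affineMeasure μ)) :
    ∀ᵐ p ∂(μ.prod μ), ∫⁻ q, ‖waveletKernel ψ χ q p * H q‖ₑ ∂(affineMeasure μ) ≤
      (eAbs (p.2 - p.1))⁻¹ * (eLpNorm (fun q => waveletKernel ψ χ q (1, 0)) 2 (affineMeasure μ) *
        eLpNorm H 2 (affineMeasure μ)) := by
  filter_upwards [(aestronglyMeasurable_waveletKernel hμ hψ hχ).prod_swap.prodMk_left,
    ae_fst_ne_snd] with p hkernel hp
  calc ∫⁻ q, ‖waveletKernel ψ χ q p * H q‖ₑ ∂(affineMeasure μ)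
      = eLpNorm ((fun q => waveletKernel ψ χ q p) • H) 1 (affineMeasure μ) :=
        eLpNorm_one_eq_lintegral_enorm.symm
    _ ≤ eLpNorm (fun q => waveletKernel ψ χ q p) 2 (affineMeasure μ) *
          eLpNorm H 2 (affineMeasure μ) := eLpNorm_smul_le_mul_eLpNorm hH hkernel
    _ = _ := by
        rw [eLpNorm_waveletKernel hμ ψ χ hp, ← neg_sub, eAbs_neg, mul_assoc]

theorem ae_lintegral_enorm_waveletKernel_mul_character_le
    (hμ : μ {x : K | valuation K x ≤ 1} = 1) (he : IsFixedCharacter e)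
    (hψ : AEStronglyMeasurable ψ μ) (hχ : AEStronglyMeasurable χ μ)
    (hH : AEStronglyMeasurable H (affineMeasure μ)) (ξ : K) :
    ∀ᵐ p ∂(μ.prod μ), ‖(e (ξ * (p.2 - p.1)) : ℂ) - 1‖ₑ *
        ∫⁻ q, ‖waveletKernel ψ χ q p * H q‖ₑ ∂(affineMeasure μ) ≤
      2 * eAbs ξ * (eLpNorm (fun q => waveletKernel ψ χ q (1, 0)) 2 (affineMeasure μ) *
        eLpNorm H 2 (affineMeasure μ)) := by
  filter_upwards [ae_lintegral_enorm_waveletKernel_mul_le hμ hψ hχ hH] with p hp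
  grw [hp, ← mul_assoc, enorm_character_sub_one_mul_le hμ he]

theorem integrable_waveletKernel_mul_character_sub_one
    (hμ : μ {x : K | valuation K x ≤ 1} = 1) (he : IsFixedCharacter e)
    (hψ : AEStronglyMeasurable ψ μ) (hχ : AEStronglyMeasurable χ μ)
    (hC : eLpNorm (fun q => waveletKernel ψ χ q (1, 0)) 2 (affineMeasure μ) ≠ ∞)
    (hH : MemLp H 2 (affineMeasure μ)) {G : K × K → ℂ} (hG : Integrable G (μ.prod μ)) (ξ : K) :
    Integrable (fun r : (K × K) × (K × K) => waveletKernel ψ χ r.1 r.2 * H r.1 *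
      (((e (ξ * (r.2.2 - r.2.1)) : ℂ) - 1) * G r.2)) ((affineMeasure μ).prod (μ.prod μ)) := by
  have hchar : Continuous fun p : K × K => (e (ξ * (p.2 - p.1)) : ℂ) - 1 := by
    have := he.continuous
    fun_prop
  have hmeas : AEStronglyMeasurable (fun r : (K × K) × (K × K) => waveletKernel ψ χ r.1 r.2 *
      H r.1 * (((e (ξ * (r.2.2 - r.2.1)) : ℂ) - 1) * G r.2))
      ((affineMeasure μ).prod (μ.prod μ)) :=
    ((aestronglyMeasurable_waveletKernel hμ hψ hχ).mul hH.1.comp_fst).mul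
      (hchar.aestronglyMeasurable.mul hG.1).comp_snd
  refine ⟨hmeas, ?_⟩
  rw [HasFiniteIntegral, lintegral_prod_symm _ hmeas.enorm]
  have hbound : ∀ᵐ p ∂(μ.prod μ), ∫⁻ q, ‖waveletKernel ψ χ q p * H q *
      (((e (ξ * (p.2 - p.1)) : ℂ) - 1) * G p)‖ₑ ∂(affineMeasure μ) ≤
      2 * eAbs ξ * (eLpNorm (fun q => waveletKernel ψ χ q (1, 0)) 2 (affineMeasure μ) *
        eLpNorm H 2 (affineMeasure μ)) * ‖G p‖ₑ := by
    filter_upwards [ae_lintegral_enorm_waveletKernel_mul_character_le hμ he hψ hχ hH.1 ξ]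
      with p hp
    simp only [enorm_mul _ (_ * G p)]
    rw [lintegral_mul_const' _ _ enorm_ne_top, enorm_mul, ← mul_assoc, mul_comm (∫⁻ _, _ ∂_)]
    gcongr
  refine (lintegral_mono_ae hbound).trans_lt ?_
  rw [lintegral_const_mul'' _ hG.1.enorm]
  exact ENNReal.mul_lt_top (ENNReal.mul_lt_top (ENNReal.mul_lt_top ENNReal.ofNat_lt_top
    (eAbs_ne_top ξ).lt_top) (ENNReal.mul_lt_top hC.lt_top hH.2)) hG.2

end Modulation

section KernelRepresentation

variable {K : Type*} [Field K] [ValuativeRel K] [TopologicalSpace K]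
  [IsNonarchimedeanLocalField K] [MeasurableSpace K] [BorelSpace K] {μ : Measure K}
  [μ.IsAddHaarMeasure] {e : AddChar K Circle} {ψ χ h g : K → ℂ} {H : K × K → ℂ}

theorem integrable_waveletForm (hμ : μ {x : K | valuation K x ≤ 1} = 1)
    (he : IsFixedCharacter e) (hψ : IsAdmissibleWavelet e μ ψ) (hχ : MemLp χ 2 μ)
    (hH : MemLp H 2 (affineMeasure μ)) (hh : MemLp h 2 μ) (hg : MemLp g 2 μ) :
    Integrable (fun q => cwt μ ψ h q.1 q.2 * (cwt μ χ g q.1 q.2 * H q)) (affineMeasure μ) :=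
  (memLp_cwt hμ he hψ hh).integrable_mul (memLp_cwt_mul hμ hχ hg hH)

theorem norm_waveletForm_le (hμ : μ {x : K | valuation K x ≤ 1} = 1)
    (he : IsFixedCharacter e) (hψ : IsAdmissibleWavelet e μ ψ) (hχ : MemLp χ 2 μ)
    (hH : MemLp H 2 (affineMeasure μ)) (hh : MemLp h 2 μ) (hg : MemLp g 2 μ) :
    ‖waveletForm μ ψ χ H h g‖ ≤
      √(admissibilityConstant e μ ψ).toReal * (eLpNorm h 2 μ).toReal *
        (eLpNorm (fun q => cwt μ χ g q.1 q.2 * H q) 2 (affineMeasure μ)).toReal := by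
  refine (norm_integral_mul_le (memLp_cwt hμ he hψ hh) (memLp_cwt_mul hμ hχ hg hH)).trans_eq ?_
  have hnorm := congrArg Real.sqrt (norm_toLp_cwt_sq hμ he hψ hh)
  rw [Real.sqrt_mul ENNReal.toReal_nonneg, Real.sqrt_sq (norm_nonneg _),
    Real.sqrt_sq (norm_nonneg _), Lp.norm_toLp, Lp.norm_toLp] at hnorm
  rw [hnorm]

/- Modulation makes Fubini applicable: `e (ξ (z - y)) - 1` cancels the singularity `|y - z|⁻¹` of
the kernel. -/
theorem waveletForm_modulate_sub (hμ : μ {x : K | valuation K x ≤ 1} = 1)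
    (he : IsFixedCharacter e) (hψ : IsAdmissibleWavelet e μ ψ) (hχ : MemLp χ 2 μ)
    (hC : eLpNorm (fun q => waveletKernel ψ χ q (1, 0)) 2 (affineMeasure μ) ≠ ∞)
    (hH : MemLp H 2 (affineMeasure μ)) (hh : MemLp h 2 μ) (hg : MemLp g 2 μ)
    (hh1 : Integrable h μ) (hg1 : Integrable g μ) (ξ : K) :
    waveletForm μ ψ χ H (modulate e ξ h) (modulate e (-ξ) g) - waveletForm μ ψ χ H h g =
      ∫ p, synthesis μ ψ χ H p * (((e (ξ * (p.2 - p.1)) : ℂ) - 1) * (g p.1 * h p.2))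
        ∂(μ.prod μ) := by
  have hh' := memLp_modulate he.continuous ξ hh
  have hg' := memLp_modulate he.continuous (-ξ) hg
  have hfubini := integral_integral_swap (f := fun q p => waveletKernel ψ χ q p * H q *
    (((e (ξ * (p.2 - p.1)) : ℂ) - 1) * (g p.1 * h p.2)))
    (integrable_waveletKernel_mul_character_sub_one hμ he hψ.1.1 hχ.1 hC hH (hg1.mul_prod hh1) ξ)
  simp only [synthesis, ← integral_mul_const]
  rw [← hfubini, waveletForm, waveletForm,
    ← integral_sub (integrable_waveletForm hμ he hψ hχ hH hh' hg')
      (integrable_waveletForm hμ he hψ hχ hH hh hg)]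
  refine integral_congr_ae (ae_affineMeasure_ne_zero.mono fun q hq => ?_)
  dsimp only
  rw [← mul_assoc, ← mul_assoc, ← sub_mul, ← integral_waveletKernel_mul,
    ← integral_waveletKernel_mul, ← integral_sub
      (integrable_waveletKernel_mul hψ.1 hχ hh' hg' hq)
      (integrable_waveletKernel_mul hψ.1 hχ hh hg hq), ← integral_mul_const]
  refine integral_congr_ae (ae_of_all _ fun p => ?_)
  dsimp only
  rw [modulate_mul_modulate]
  ring

theorem tendsto_cwt_modulate (he : IsFixedCharacter e) {ϖ : K} (h1 : valuation K ϖ < 1)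
    (h0 : ϖ ≠ 0) (hχ : MemLp χ 2 μ) (hg : MemLp g 2 μ) {a : K} (ha : a ≠ 0) (b : K) :
    Tendsto (fun n : ℕ => cwt μ χ (modulate e (-(ϖ ^ n)⁻¹) g) a b) atTop (𝓝 0) := by
  obtain ⟨s, -, hs⟩ := he.nontrivial
  have hint : Integrable (fun x => g x * conj (daughter χ a b x)) μ :=
    hg.integrable_mul (memLp_conj (memLp_daughter hχ ha b))
  have hv : Tendsto (fun n : ℕ => -(ϖ ^ n * s)) atTop (𝓝 0) := by
    simpa using ((tendsto_pow_zero h1).mul_const s).neg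
  refine (tendsto_integral_mul_addChar hint (E := fun n : ℕ => e.mulShift (-(ϖ ^ n)⁻¹))
    (fun n => he.continuous.comp (continuous_const_mul _)) hv hs fun n => ?_).congr fun n => ?_
  · rw [AddChar.mulShift_apply, neg_mul_neg, inv_mul_cancel_left₀ (pow_ne_zero n h0)]
  · refine integral_congr_ae (ae_of_all _ fun x => ?_)
    simp only [AddChar.mulShift_apply, modulate]
    ring

theorem tendsto_waveletForm_modulate (hμ : μ {x : K | valuation K x ≤ 1} = 1)
    (he : IsFixedCharacter e) {ϖ : K} (h1 : valuation K ϖ < 1) (h0 : ϖ ≠ 0)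
    (hψ : IsAdmissibleWavelet e μ ψ) (hχ : MemLp χ 2 μ) (hH : MemLp H 2 (affineMeasure μ))
    (hh : MemLp h 2 μ) (hg : MemLp g 2 μ) :
    Tendsto (fun n : ℕ => waveletForm μ ψ χ H (modulate e (ϖ ^ n)⁻¹ h)
      (modulate e (-(ϖ ^ n)⁻¹) g)) atTop (𝓝 0) := by
  have hmod := fun n : ℕ => memLp_modulate he.continuous (-(ϖ ^ n)⁻¹) hg
  have hdominated : Tendsto (fun n : ℕ => eLpNorm
      (fun q => cwt μ χ (modulate e (-(ϖ ^ n)⁻¹) g) q.1 q.2 * H q) 2 (affineMeasure μ))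
      atTop (𝓝 0) := by
    refine tendsto_eLpNorm_two_zero_of_dominated
      (hH.const_mul (((eLpNorm g 2 μ).toReal * (eLpNorm χ 2 μ).toReal : ℝ) : ℂ))
      (fun n => (memLp_cwt_mul hμ hχ (hmod n) hH).1)
      (fun n => ae_affineMeasure_ne_zero.mono fun q hq => ?_)
      (ae_affineMeasure_ne_zero.mono fun q hq => ?_)
    · rw [norm_mul, norm_mul, Complex.norm_of_nonneg (by positivity),
        ← eLpNorm_modulate (e := e) (-(ϖ ^ n)⁻¹) g]
      exact mul_le_mul_of_nonneg_right (norm_cwt_le hχ (hmod n) hq q.2) (norm_nonneg _)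
    · simpa using (tendsto_cwt_modulate he h1 h0 hχ hg hq q.2).mul_const (H q)
  refine squeeze_zero_norm (fun n => norm_waveletForm_le hμ he hψ hχ hH
    (memLp_modulate he.continuous _ hh) (hmod n)) ?_
  simp only [eLpNorm_modulate _ h]
  simpa using ((ENNReal.tendsto_toReal ENNReal.zero_ne_top).comp hdominated).const_mul _

theorem tendsto_integral_mul_character_sub (he : IsFixedCharacter e) {ϖ : K}
    (h1 : valuation K ϖ < 1) (h0 : ϖ ≠ 0) {W : K × K → ℂ} (hW : Integrable W (μ.prod μ)) :
    Tendsto (fun n : ℕ => ∫ p, W p * e ((ϖ ^ n)⁻¹ * (p.2 - p.1)) ∂(μ.prod μ)) atTop (𝓝 0) := by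
  obtain ⟨s, -, hs⟩ := he.nontrivial
  have hv : Tendsto (fun n : ℕ => ((0, ϖ ^ n * s) : K × K)) atTop (𝓝 0) :=
    tendsto_const_nhds.prodMk_nhds (by simpa using (tendsto_pow_zero h1).mul_const s)
  refine tendsto_integral_mul_addChar hW (E := fun n : ℕ =>
    (e.mulShift (ϖ ^ n)⁻¹).compAddMonoidHom (AddMonoidHom.snd K K - AddMonoidHom.fst K K))
    (fun n => he.continuous.comp
      ((continuous_const_mul _).comp (continuous_snd.sub continuous_fst))) hv hs fun n => ?_
  simp [inv_mul_cancel_left₀ (pow_ne_zero n h0)]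

theorem waveletForm_eq_integral_of_integrable (hμ : μ {x : K | valuation K x ≤ 1} = 1)
    (he : IsFixedCharacter e) (hψ : IsAdmissibleWavelet e μ ψ) (hχ : MemLp χ 2 μ)
    (hC : eLpNorm (fun q => waveletKernel ψ χ q (1, 0)) 2 (affineMeasure μ) ≠ ∞)
    (hH : MemLp H 2 (affineMeasure μ)) (hh : MemLp h 2 μ) (hg : MemLp g 2 μ)
    (hh1 : Integrable h μ) (hg1 : Integrable g μ)
    (hS : Integrable (fun p : K × K => synthesis μ ψ χ H p * (g p.1 * h p.2)) (μ.prod μ)) :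
    waveletForm μ ψ χ H h g = ∫ p, synthesis μ ψ χ H p * (g p.1 * h p.2) ∂(μ.prod μ) := by
  obtain ⟨ϖ, h0, h1⟩ := exists_valuation_lt_one K
  have hsub (n : ℕ) : waveletForm μ ψ χ H (modulate e (ϖ ^ n)⁻¹ h) (modulate e (-(ϖ ^ n)⁻¹) g) -
      ∫ p, synthesis μ ψ χ H p * (g p.1 * h p.2) * e ((ϖ ^ n)⁻¹ * (p.2 - p.1)) ∂(μ.prod μ) =
      waveletForm μ ψ χ H h g - ∫ p, synthesis μ ψ χ H p * (g p.1 * h p.2) ∂(μ.prod μ) := by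
    have hchar : Continuous fun p : K × K => (e ((ϖ ^ n)⁻¹ * (p.2 - p.1)) : ℂ) := by
      have := he.continuous
      fun_prop
    have hSchar := hS.mul_bdd (c := 1) hchar.aestronglyMeasurable
      (ae_of_all _ fun p => (Circle.norm_coe _).le)
    rw [sub_eq_sub_iff_sub_eq_sub, waveletForm_modulate_sub hμ he hψ hχ hC hH hh hg hh1 hg1,
      ← integral_sub hSchar hS]
    refine integral_congr_ae (ae_of_all _ fun p => ?_)
    ring
  have hlim := (tendsto_waveletForm_modulate hμ he h1 h0 hψ hχ hH hh hg).sub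
    (tendsto_integral_mul_character_sub he h1 h0 hS)
  simp only [hsub, sub_zero] at hlim
  exact sub_eq_zero.1 (tendsto_nhds_unique tendsto_const_nhds hlim)

theorem waveletForm_sub_left (hμ : μ {x : K | valuation K x ≤ 1} = 1)
    (he : IsFixedCharacter e) (hψ : IsAdmissibleWavelet e μ ψ) (hχ : MemLp χ 2 μ)
    (hH : MemLp H 2 (affineMeasure μ)) {h' : K → ℂ} (hh : MemLp h 2 μ) (hh' : MemLp h' 2 μ)
    (hg : MemLp g 2 μ) :
    waveletForm μ ψ χ H (h - h') g = waveletForm μ ψ χ H h g - waveletForm μ ψ χ H h' g := by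
  rw [waveletForm, waveletForm, waveletForm,
    ← integral_sub (integrable_waveletForm hμ he hψ hχ hH hh hg)
      (integrable_waveletForm hμ he hψ hχ hH hh' hg)]
  refine integral_congr_ae (ae_affineMeasure_ne_zero.mono fun q hq => ?_)
  dsimp only
  rw [cwt_sub hψ.1 hh hh' hq, sub_mul]

theorem waveletForm_sub_right (hμ : μ {x : K | valuation K x ≤ 1} = 1)
    (he : IsFixedCharacter e) (hψ : IsAdmissibleWavelet e μ ψ) (hχ : MemLp χ 2 μ)
    (hH : MemLp H 2 (affineMeasure μ)) {g' : K → ℂ} (hh : MemLp h 2 μ) (hg : MemLp g 2 μ)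
    (hg' : MemLp g' 2 μ) :
    waveletForm μ ψ χ H h (g - g') = waveletForm μ ψ χ H h g - waveletForm μ ψ χ H h g' := by
  rw [waveletForm, waveletForm, waveletForm,
    ← integral_sub (integrable_waveletForm hμ he hψ hχ hH hh hg)
      (integrable_waveletForm hμ he hψ hχ hH hh hg')]
  refine integral_congr_ae (ae_affineMeasure_ne_zero.mono fun q hq => ?_)
  dsimp only
  rw [cwt_sub hχ hg hg' hq, sub_mul, mul_sub]

theorem norm_waveletForm_le_mul (hμ : μ {x : K | valuation K x ≤ 1} = 1)
    (he : IsFixedCharacter e) (hψ : IsAdmissibleWavelet e μ ψ) (hχ : MemLp χ 2 μ)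
    (hH : MemLp H 2 (affineMeasure μ)) (hh : MemLp h 2 μ) (hg : MemLp g 2 μ) :
    ‖waveletForm μ ψ χ H h g‖ ≤ √(admissibilityConstant e μ ψ).toReal * (eLpNorm h 2 μ).toReal *
      (eLpNorm g 2 μ * eLpNorm χ 2 μ * eLpNorm H 2 (affineMeasure μ)).toReal := by
  refine (norm_waveletForm_le hμ he hψ hχ hH hh hg).trans ?_
  gcongr
  · exact ENNReal.mul_ne_top (ENNReal.mul_ne_top hg.2.ne hχ.2.ne) hH.2.ne
  · exact eLpNorm_cwt_mul_le hχ hg H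

theorem tendsto_waveletForm (hμ : μ {x : K | valuation K x ≤ 1} = 1)
    (he : IsFixedCharacter e) (hψ : IsAdmissibleWavelet e μ ψ) (hχ : MemLp χ 2 μ)
    (hH : MemLp H 2 (affineMeasure μ)) (hh : MemLp h 2 μ) (hg : MemLp g 2 μ)
    {u v : ℕ → K → ℂ} (hu : ∀ n, MemLp (u n) 2 μ) (hv : ∀ n, MemLp (v n) 2 μ)
    (huh : Tendsto (fun n => eLpNorm (u n - h) 2 μ) atTop (𝓝 0))
    (hvg : Tendsto (fun n => eLpNorm (v n - g) 2 μ) atTop (𝓝 0)) :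
    Tendsto (fun n => waveletForm μ ψ χ H (u n) (v n)) atTop (𝓝 (waveletForm μ ψ χ H h g)) := by
  have hleft := (ENNReal.tendsto_toReal ENNReal.zero_ne_top).comp huh
  have hright := (ENNReal.tendsto_toReal ENNReal.zero_ne_top).comp hvg
  set B : (K → ℂ) → (K → ℂ) → ℝ := fun h g => √(admissibilityConstant e μ ψ).toReal *
    (eLpNorm h 2 μ).toReal * (eLpNorm g 2 μ * eLpNorm χ 2 μ * eLpNorm H 2 (affineMeasure μ)).toReal
    with hB
  have hle {h g : K → ℂ} (hh : MemLp h 2 μ) (hg : MemLp g 2 μ) :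
      ‖waveletForm μ ψ χ H h g‖ ≤ B h g := norm_waveletForm_le_mul hμ he hψ hχ hH hh hg
  have hbound : Tendsto (fun n => B (u n - h) (v n - g) + B (u n - h) g + B h (v n - g)) atTop
      (𝓝 0) := by
    simp only [hB, ENNReal.toReal_mul]
    simpa using ((((hleft.const_mul _).mul ((hright.mul_const _).mul_const _))).add
      ((hleft.const_mul _).mul_const _)).add (((hright.mul_const _).mul_const _).const_mul _)
  refine tendsto_iff_norm_sub_tendsto_zero.2
    (squeeze_zero (fun n => norm_nonneg _) (fun n => ?_) hbound)
  have hsplit : waveletForm μ ψ χ H (u n) (v n) - waveletForm μ ψ χ H h g =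
      waveletForm μ ψ χ H (u n - h) (v n - g) + waveletForm μ ψ χ H (u n - h) g +
        waveletForm μ ψ χ H h (v n - g) := by
    have hun := (hu n).sub hh
    rw [waveletForm_sub_right hμ he hψ hχ hH hun (hv n) hg,
      waveletForm_sub_right hμ he hψ hχ hH hh (hv n) hg,
      waveletForm_sub_left hμ he hψ hχ hH (hu n) hh (hv n)]
    ring
  rw [hsplit]
  exact norm_add₃_le.trans (add_le_add (add_le_add (hle ((hu n).sub hh) ((hv n).sub hg))
    (hle ((hu n).sub hh) hg)) (hle hh ((hv n).sub hg)))

theorem waveletForm_eq_integral (hμ : μ {x : K | valuation K x ≤ 1} = 1)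
    (he : IsFixedCharacter e) (hψ : IsAdmissibleWavelet e μ ψ) (hχ : MemLp χ 2 μ)
    (hC : eLpNorm (fun q => waveletKernel ψ χ q (1, 0)) 2 (affineMeasure μ) ≠ ∞)
    (hH : MemLp H 2 (affineMeasure μ)) (hh : MemLp h 2 μ) (hg : MemLp g 2 μ)
    (hS : Integrable (fun p : K × K => synthesis μ ψ χ H p * (g p.1 * h p.2)) (μ.prod μ)) :
    waveletForm μ ψ χ H h g = ∫ p, synthesis μ ψ χ H p * (g p.1 * h p.2) ∂(μ.prod μ) := by
  obtain ⟨ϖ, h0, h1⟩ := exists_valuation_lt_one K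
  let V (n : ℕ) : Set K := {x | valuation K x ≤ valuation K (ϖ ^ n)⁻¹}
  have hV : AECover μ atTop V := aecover_valuation_le_inv_pow μ h0 h1
  have hVV : AECover (μ.prod μ) atTop fun n => V n ×ˢ V n :=
    ⟨ae_of_all _ fun p => (eventually_valuation_le_inv_pow h0 h1 p.1).and
      (eventually_valuation_le_inv_pow h0 h1 p.2),
      fun n => (hV.measurableSet n).prod (hV.measurableSet n)⟩
  have hmemLp {f : K → ℂ} (hf : MemLp f 2 μ) (n : ℕ) : MemLp ((V n).indicator f) 2 μ :=
    hf.indicator (hV.measurableSet n)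
  have hint {f : K → ℂ} (hf : MemLp f 2 μ) (n : ℕ) : Integrable ((V n).indicator f) μ := by
    have : IsFiniteMeasure (μ.restrict (V n)) := isFiniteMeasure_restrict.2 <| by
      rw [measure_valuation_le hμ (inv_ne_zero (pow_ne_zero n h0))]
      exact eAbs_ne_top _
    exact (integrable_indicator_iff (hV.measurableSet n)).2 (hf.restrict _ |>.integrable one_le_two)
  have hprod (n : ℕ) : (fun p : K × K => synthesis μ ψ χ H p *
      ((V n).indicator g p.1 * (V n).indicator h p.2)) =
      (V n ×ˢ V n).indicator fun p => synthesis μ ψ χ H p * (g p.1 * h p.2) := by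
    ext p
    by_cases hy : p.1 ∈ V n <;> by_cases hz : p.2 ∈ V n <;> simp [hy, hz, Set.indicator]
  refine tendsto_nhds_unique (tendsto_waveletForm hμ he hψ hχ hH hh hg (hmemLp hh) (hmemLp hg)
    (tendsto_eLpNorm_two_indicator_sub hh hV) (tendsto_eLpNorm_two_indicator_sub hg hV))
    ((hVV.integral_tendsto_of_countably_generated hS).congr fun n => ?_)
  rw [waveletForm_eq_integral_of_integrable hμ he hψ hχ hC hH (hmemLp hh n) (hmemLp hg n)
    (hint hh n) (hint hg n), hprod, integral_indicator (hVV.measurableSet n)]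
  exact hprod n ▸ hS.indicator (hVV.measurableSet n)

end KernelRepresentation

section ProductMeasure

variable {X Y E : Type*} [MeasurableSpace X] [MeasurableSpace Y] {ν : Measure X} {ρ : Measure Y}

theorem ae_eq_prod_of_ae_ae_eq [SFinite ρ] [TopologicalSpace E]
    [TopologicalSpace.MetrizableSpace E] {f g : X × Y → E} (hf : AEStronglyMeasurable f (ν.prod ρ))
    (hg : AEStronglyMeasurable g (ν.prod ρ)) (hfg : ∀ᵐ x ∂ν, ∀ᵐ y ∂ρ, f (x, y) = g (x, y)) :
    f =ᵐ[ν.prod ρ] g := by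
  have hmk : hf.mk f =ᵐ[ν.prod ρ] hg.mk g := by
    refine (Measure.ae_prod_iff_ae_ae
      (hf.stronglyMeasurable_mk.measurableSet_eq_fun hg.stronglyMeasurable_mk)).2 ?_
    filter_upwards [hfg, Measure.ae_ae_of_ae_prod hf.ae_eq_mk,
      Measure.ae_ae_of_ae_prod hg.ae_eq_mk] with x hx hfx hgx
    filter_upwards [hx, hfx, hgx] with y hy hfy hgy
    rw [← hfy, hy, hgy]
  exact hf.ae_eq_mk.trans (hmk.trans hg.ae_eq_mk.symm)

theorem ae_eq_of_forall_setIntegral_eq_of_norm_le [SigmaFinite ν] [NormedAddCommGroup E]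
    [NormedSpace ℝ E] [CompleteSpace E] {f v : X → E} {N : X → ℝ} (hf : AEStronglyMeasurable f ν)
    (hN : AEMeasurable N ν) (hfN : ∀ᵐ x ∂ν, ‖f x‖ ≤ N x)
    (hv : ∀ s, MeasurableSet s → ν s < ∞ → IntegrableOn v s ν)
    (hfv : ∀ s, MeasurableSet s → ν s < ∞ → IntegrableOn N s ν →
      ∫ x in s, f x ∂ν = ∫ x in s, v x ∂ν) :
    f =ᵐ[ν] v := by
  let S (n : ℕ) : Set X := spanningSets ν n ∩ {x | hN.mk N x ≤ n}
  have hS (n : ℕ) : MeasurableSet (S n) :=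
    (measurableSet_spanningSets ν n).inter (measurableSet_le hN.measurable_mk measurable_const)
  have hSfin (n : ℕ) : ν (S n) < ∞ :=
    (measure_mono Set.inter_subset_left).trans_lt (measure_spanningSets_lt_top ν n)
  have hcover : ⋃ n, S n = Set.univ := by
    refine Set.eq_univ_of_forall fun x => Set.mem_iUnion.2 ?_
    obtain ⟨n, hn⟩ := exists_nat_ge (hN.mk N x)
    refine ⟨max (spanningSetsIndex ν x) n, ?_, hn.trans (by simp)⟩
    exact monotone_spanningSets ν (le_max_left _ n) (mem_spanningSetsIndex ν x)
  have hNint (n : ℕ) : IntegrableOn N (S n) ν := by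
    refine Measure.integrableOn_of_bounded (M := n) (hSfin n).ne hN.aestronglyMeasurable ?_
    rw [ae_restrict_iff' (hS n)]
    filter_upwards [hN.ae_eq_mk, hfN] with x hx hfx hxS
    rw [Real.norm_of_nonneg ((norm_nonneg _).trans hfx), hx]
    exact hxS.2
  have hpiece (n : ℕ) : f =ᵐ[ν.restrict (S n)] v := by
    refine Integrable.ae_eq_of_forall_setIntegral_eq f v
      ((hNint n).mono' hf.restrict (ae_restrict_of_ae hfN)) (hv _ (hS n) (hSfin n))
      fun s hs _ => ?_
    rw [Measure.restrict_restrict hs]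
    exact hfv _ (hs.inter (hS n)) ((measure_mono Set.inter_subset_right).trans_lt (hSfin n))
      ((hNint n).mono_set Set.inter_subset_right)
  have hunion := (ae_restrict_iUnion_iff S fun x => f x = v x).2 hpiece
  rwa [hcover, Measure.restrict_univ] at hunion

end ProductMeasure

section BasicFunction

variable {K : Type*} [Field K] [ValuativeRel K] [TopologicalSpace K]
  [IsNonarchimedeanLocalField K] [MeasurableSpace K] [BorelSpace K]
  {μ : Measure K} [μ.IsAddHaarMeasure] {e : AddChar K Circle} {ψ φ χ : K → ℂ} {D : K → K → K → ℂ}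

theorem IsBasicFunction.aestronglyMeasurable_cwt (hμ : μ {x : K | valuation K x ≤ 1} = 1)
    (hφ : AEStronglyMeasurable φ μ) (hD : IsBasicFunction μ ψ φ χ D) :
    AEStronglyMeasurable
      (fun r : (K × K) × (K × K) => cwt μ φ (fun x => D x r.2.1 r.2.2) r.1.1 r.1.2)
      ((affineMeasure μ).prod (μ.prod μ)) := by
  have hDx := hD.aestronglyMeasurable.comp_quasiMeasurePreserving
    (Measure.measurePreserving_swap.quasiMeasurePreserving.comp
      (QuasiMeasurePreserving.prodMap
        (Measure.quasiMeasurePreserving_snd (μ := affineMeasure μ) (ν := μ.prod μ))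
        (Measure.QuasiMeasurePreserving.id μ)))
  have hdaughter := aestronglyMeasurable_daughter (ν := (affineMeasure μ).prod (μ.prod μ)) hμ hφ
    (α := fun r => r.1.1) (β := fun r => r.1.2) (by fun_prop) (by fun_prop)
    (Measure.quasiMeasurePreserving_fst.ae ae_affineMeasure_ne_zero)
  exact (hDx.mul
    (Complex.continuous_conj.comp_aestronglyMeasurable hdaughter)).integral_prod_right'

theorem IsBasicFunction.ae_cwt_eq (hμ : μ {x : K | valuation K x ≤ 1} = 1)
    (hψ : AEStronglyMeasurable ψ μ) (hφ : AEStronglyMeasurable φ μ)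
    (hχ : AEStronglyMeasurable χ μ) (hD : IsBasicFunction μ ψ φ χ D) :
    ∀ᵐ p ∂(μ.prod μ), ∀ᵐ q ∂(affineMeasure μ),
      cwt μ φ (fun x => D x p.1 p.2) q.1 q.2 = waveletKernel ψ χ q p := by
  have hprod := ae_eq_prod_of_ae_ae_eq (hD.aestronglyMeasurable_cwt hμ hφ)
    (aestronglyMeasurable_waveletKernel hμ hψ hχ)
    (ae_affineMeasure_ne_zero.mono fun q hq => hD.cwt_eq q.1 q.2 hq)
  exact Measure.ae_ae_of_ae_prod (Measure.measurePreserving_swap.quasiMeasurePreserving.ae hprod)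

theorem IsBasicFunction.eLpNorm_waveletKernel_ne_top (hμ : μ {x : K | valuation K x ≤ 1} = 1)
    (he : IsFixedCharacter e) (hψ : AEStronglyMeasurable ψ μ) (hφ : IsAdmissibleWavelet e μ φ)
    (hχ : AEStronglyMeasurable χ μ) (hD : IsBasicFunction μ ψ φ χ D) :
    eLpNorm (fun q => waveletKernel ψ χ q (1, 0)) 2 (affineMeasure μ) ≠ ∞ := by
  obtain ⟨p, hcwt, hDp, hp⟩ :=
    ((hD.ae_cwt_eq hμ hψ hφ.1.1 hχ).and (hD.memLp.and ae_fst_ne_snd)).exists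
  have hfin := (memLp_cwt hμ he hφ hDp).2.ne
  rw [eLpNorm_congr_ae hcwt, eLpNorm_waveletKernel hμ ψ χ hp] at hfin
  exact fun htop => hfin (by
    rw [htop, ENNReal.mul_top (ENNReal.inv_ne_zero.2 (eAbs_ne_top _))])

theorem IsBasicFunction.ae_synthesis_eq (hμ : μ {x : K | valuation K x ≤ 1} = 1)
    (he : IsFixedCharacter e) (hψ : AEStronglyMeasurable ψ μ) (hφ : IsAdmissibleWavelet e μ φ)
    (hχ : AEStronglyMeasurable χ μ) (hD : IsBasicFunction μ ψ φ χ D) {w : K → ℂ}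
    (hw : MemLp w 2 μ) :
    ∀ᵐ p ∂(μ.prod μ), synthesis μ ψ χ (fun q => conj (cwt μ φ w q.1 q.2)) p =
      (admissibilityConstant e μ φ).toReal * ∫ x, D x p.1 p.2 * conj (w x) ∂μ := by
  filter_upwards [hD.ae_cwt_eq hμ hψ hφ.1.1 hχ, hD.memLp] with p hcwt hDp
  rw [← integral_cwt_mul_conj_cwt hμ he hφ hDp hw]
  exact integral_congr_ae (hcwt.mono fun q hq => by dsimp only; rw [hq])

end BasicFunction

section Convolution

open scoped InnerProduct

variable {K : Type*} [MeasurableSpace K] {μ : Measure K} {D : K → K → K → ℂ} {h g : K → ℂ}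

theorem assocConv_ae_eq_integral [SFinite μ]
    (hconv : ∀ᵐ x ∂μ, Integrable (fun p : K × K => D x p.1 p.2 * h p.2 * g p.1) (μ.prod μ)) :
    assocConv μ D h g =ᵐ[μ] fun x => ∫ p, D x p.1 p.2 * h p.2 * g p.1 ∂(μ.prod μ) := by
  filter_upwards [hconv] with x hx
  rw [integral_prod _ hx, assocConv]
  simp only [translation, integral_mul_const]

variable [Field K] [ValuativeRel K] [TopologicalSpace K] [IsNonarchimedeanLocalField K]
  {e : AddChar K Circle} {ψ φ χ : K → ℂ}

theorem IsBasicFunction.aestronglyMeasurable_mul_mul (hD : IsBasicFunction μ ψ φ χ D)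
    (hh : AEStronglyMeasurable h μ) (hg : AEStronglyMeasurable g μ) :
    AEStronglyMeasurable (fun r : K × K × K => D r.1 r.2.1 r.2.2 * h r.2.2 * g r.2.1)
      (μ.prod (μ.prod μ)) :=
  (hD.aestronglyMeasurable.mul hh.comp_snd.comp_snd).mul hg.comp_fst.comp_snd

theorem IsBasicFunction.integrable_mul_mul_conj_indicator [SFinite μ]
    (hD : IsBasicFunction μ ψ φ χ D) (hh : AEStronglyMeasurable h μ) (hg : AEStronglyMeasurable g μ)
    (hconv : ∀ᵐ x ∂μ, Integrable (fun p : K × K => D x p.1 p.2 * h p.2 * g p.1) (μ.prod μ))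
    {s : Set K} (hs : MeasurableSet s)
    (hint : IntegrableOn (fun x => ∫ p, ‖D x p.1 p.2 * h p.2 * g p.1‖ ∂(μ.prod μ)) s μ) :
    Integrable (fun r : K × K × K =>
      D r.1 r.2.1 r.2.2 * h r.2.2 * g r.2.1 * conj (s.indicator (1 : K → ℂ) r.1))
      (μ.prod (μ.prod μ)) := by
  have hindicator : AEStronglyMeasurable (fun x => conj (s.indicator (1 : K → ℂ) x)) μ :=
    Complex.continuous_conj.comp_aestronglyMeasurable (aestronglyMeasurable_one.indicator hs)
  have hmeas : AEStronglyMeasurable (fun r : K × K × K =>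
      D r.1 r.2.1 r.2.2 * h r.2.2 * g r.2.1 * conj (s.indicator (1 : K → ℂ) r.1))
      (μ.prod (μ.prod μ)) :=
    (hD.aestronglyMeasurable_mul_mul hh hg).mul hindicator.comp_fst
  have hnorm := (integrable_indicator_iff hs).2 hint
  refine (integrable_prod_iff hmeas).2 ⟨hconv.mono fun x hx => ?_,
    hnorm.congr (ae_of_all _ fun x => ?_)⟩
  · exact hx.mul_const (conj (s.indicator (1 : K → ℂ) x))
  · by_cases hx : x ∈ s <;> simp [hx]

variable [BorelSpace K] [μ.IsAddHaarMeasure]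

theorem memLp_cwt_mul_cwt (hμ : μ {x : K | valuation K x ≤ 1} = 1) (he : IsFixedCharacter e)
    (hψ : IsAdmissibleWavelet e μ ψ) (hχ : MemLp χ 2 μ) (hh : MemLp h 2 μ) (hg : MemLp g 2 μ) :
    MemLp (fun q => cwt μ χ g q.1 q.2 * cwt μ ψ h q.1 q.2) 2 (affineMeasure μ) :=
  memLp_cwt_mul hμ hχ hg (memLp_cwt hμ he hψ hh)

/-- The element `c_φ⁻¹ W_φ† (K_ψ h · K_χ g)` of `L²(K)`, where `W_φ` is the wavelet transform of `φ`
as an operator; it turns out to be the associated convolution `h # g`. -/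
noncomputable def convolutionLp (hμ : μ {x : K | valuation K x ≤ 1} = 1)
    (he : IsFixedCharacter e) (hψ : IsAdmissibleWavelet e μ ψ) (hφ : IsAdmissibleWavelet e μ φ)
    (hχ : MemLp χ 2 μ) (hh : MemLp h 2 μ) (hg : MemLp g 2 μ) : Lp ℂ 2 μ :=
  ((admissibilityConstant e μ φ).toReal : ℂ)⁻¹ •
    (cwtLp hμ he hφ).adjoint ((memLp_cwt_mul_cwt hμ he hψ hχ hh hg).toLp _)

theorem mul_integral_convolutionLp_mul_conj (hμ : μ {x : K | valuation K x ≤ 1} = 1)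
    (he : IsFixedCharacter e) (hψ : IsAdmissibleWavelet e μ ψ) (hφ : IsAdmissibleWavelet e μ φ)
    (hχ : MemLp χ 2 μ) (hh : MemLp h 2 μ) (hg : MemLp g 2 μ)
    (hc : (admissibilityConstant e μ φ).toReal ≠ 0) {w : K → ℂ} (hw : MemLp w 2 μ) :
    (admissibilityConstant e μ φ).toReal *
        ∫ x, convolutionLp hμ he hψ hφ hχ hh hg x * conj (w x) ∂μ =
      waveletForm μ ψ χ (fun q => conj (cwt μ φ w q.1 q.2)) h g := by
  rw [← inner_toLp (Lp.memLp _) hw, Lp.toLp_coeFn, convolutionLp, inner_smul_right,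
    mul_inv_cancel_left₀ (Complex.ofReal_ne_zero.2 hc), ContinuousLinearMap.adjoint_inner_right,
    cwtLp_toLp hμ he hφ hw, inner_toLp, waveletForm]
  refine integral_congr_ae (ae_of_all _ fun q => ?_)
  ring

theorem cwt_convolutionLp (hμ : μ {x : K | valuation K x ≤ 1} = 1)
    (he : IsFixedCharacter e) (hψ : IsAdmissibleWavelet e μ ψ) (hφ : IsAdmissibleWavelet e μ φ)
    (hχ : MemLp χ 2 μ) (hh : MemLp h 2 μ) (hg : MemLp g 2 μ)
    (hc : (admissibilityConstant e μ φ).toReal ≠ 0) (hD : IsBasicFunction μ ψ φ χ D) {a : K}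
    (ha : a ≠ 0) (b : K) :
    cwt μ φ (convolutionLp hμ he hψ hφ hχ hh hg) a b = cwt μ ψ h a b * cwt μ χ g a b := by
  have hdaughter := memLp_daughter hφ.1 ha b
  have hsynthesis : (fun p : K × K => synthesis μ ψ χ
      (fun q => conj (cwt μ φ (daughter φ a b) q.1 q.2)) p * (g p.1 * h p.2)) =ᵐ[μ.prod μ]
      fun p => (admissibilityConstant e μ φ).toReal *
        (waveletKernel ψ χ (a, b) p * (g p.1 * h p.2)) := by
    filter_upwards [hD.ae_synthesis_eq hμ he hψ.1.1 hφ hχ.1 hdaughter, hD.cwt_eq a b ha]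
      with p hp hcwt
    rw [hp, mul_assoc, waveletKernel, ← hcwt, cwt]
  have hint := (integrable_congr hsynthesis).2
    ((integrable_waveletKernel_mul (q := (a, b)) hψ.1 hχ hh hg ha).const_mul _)
  refine mul_left_cancel₀ (Complex.ofReal_ne_zero.2 hc) ?_
  rw [cwt, mul_integral_convolutionLp_mul_conj hμ he hψ hφ hχ hh hg hc hdaughter,
    waveletForm_eq_integral hμ he hψ hχ (hD.eLpNorm_waveletKernel_ne_top hμ he hψ.1.1 hφ hχ.1)
      (memLp_conj (memLp_cwt hμ he hφ hdaughter)) hh hg hint, integral_congr_ae hsynthesis,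
    integral_const_mul, integral_waveletKernel_mul]

theorem mul_integral_assocConv_mul_conj (hμ : μ {x : K | valuation K x ≤ 1} = 1)
    (he : IsFixedCharacter e) (hψ : IsAdmissibleWavelet e μ ψ) (hφ : IsAdmissibleWavelet e μ φ)
    (hχ : MemLp χ 2 μ) (hh : MemLp h 2 μ) (hg : MemLp g 2 μ) (hD : IsBasicFunction μ ψ φ χ D)
    (hconv : ∀ᵐ x ∂μ, Integrable (fun p : K × K => D x p.1 p.2 * h p.2 * g p.1) (μ.prod μ))
    {w : K → ℂ} (hw : MemLp w 2 μ)
    (hint : Integrable (fun r : K × K × K => D r.1 r.2.1 r.2.2 * h r.2.2 * g r.2.1 * conj (w r.1))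
      (μ.prod (μ.prod μ))) :
    (admissibilityConstant e μ φ).toReal * ∫ x, assocConv μ D h g x * conj (w x) ∂μ =
      waveletForm μ ψ χ (fun q => conj (cwt μ φ w q.1 q.2)) h g := by
  have hsynthesis : (fun p : K × K => synthesis μ ψ χ (fun q => conj (cwt μ φ w q.1 q.2)) p *
      (g p.1 * h p.2)) =ᵐ[μ.prod μ] fun p => (admissibilityConstant e μ φ).toReal *
        ∫ x, D x p.1 p.2 * h p.2 * g p.1 * conj (w x) ∂μ := by
    filter_upwards [hD.ae_synthesis_eq hμ he hψ.1.1 hφ hχ.1 hw] with p hp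
    rw [hp, mul_assoc, ← integral_mul_const]
    congr with x
    ring
  rw [waveletForm_eq_integral hμ he hψ hχ (hD.eLpNorm_waveletKernel_ne_top hμ he hψ.1.1 hφ hχ.1)
    (memLp_conj (memLp_cwt hμ he hφ hw)) hh hg
    ((integrable_congr hsynthesis).2 (hint.integral_prod_right.const_mul _)),
    integral_congr_ae hsynthesis, integral_const_mul, ← integral_integral_swap hint]
  congr 1
  refine integral_congr_ae ((assocConv_ae_eq_integral hconv).mono fun x hx => ?_)
  dsimp only
  rw [hx, integral_mul_const]

theorem assocConv_ae_eq_convolutionLp (hμ : μ {x : K | valuation K x ≤ 1} = 1)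
    (he : IsFixedCharacter e) (hψ : IsAdmissibleWavelet e μ ψ) (hφ : IsAdmissibleWavelet e μ φ)
    (hχ : MemLp χ 2 μ) (hh : MemLp h 2 μ) (hg : MemLp g 2 μ)
    (hc : (admissibilityConstant e μ φ).toReal ≠ 0) (hD : IsBasicFunction μ ψ φ χ D)
    (hconv : ∀ᵐ x ∂μ, Integrable (fun p : K × K => D x p.1 p.2 * h p.2 * g p.1) (μ.prod μ)) :
    assocConv μ D h g =ᵐ[μ] convolutionLp hμ he hψ hφ hχ hh hg := by
  have hmeas := hD.aestronglyMeasurable_mul_mul hh.1 hg.1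
  have hconvEq := assocConv_ae_eq_integral hconv
  refine ae_eq_of_forall_setIntegral_eq_of_norm_le
    (N := fun x => ∫ p, ‖D x p.1 p.2 * h p.2 * g p.1‖ ∂(μ.prod μ))
    (hmeas.integral_prod_right'.congr hconvEq.symm) hmeas.norm.integral_prod_right'.aemeasurable
    (hconvEq.mono fun x hx => hx ▸ norm_integral_le_integral_norm _)
    (fun s _ hsfin => ?_) fun s hs hsfin hint => ?_
  · have : IsFiniteMeasure (μ.restrict s) := isFiniteMeasure_restrict.2 hsfin.ne
    exact ((Lp.memLp _).restrict s).integrable one_le_two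
  · have hw : MemLp (s.indicator (1 : K → ℂ)) 2 μ := memLp_indicator_const 2 hs 1 (.inr hsfin.ne)
    have hset (f : K → ℂ) :
        ∫ x, f x * conj (s.indicator (1 : K → ℂ) x) ∂μ = ∫ x in s, f x ∂μ := by
      rw [← integral_indicator hs]
      congr with x
      by_cases hx : x ∈ s <;> simp [hx]
    refine mul_left_cancel₀ (Complex.ofReal_ne_zero.2 hc) ?_
    rw [← hset, ← hset, mul_integral_convolutionLp_mul_conj hμ he hψ hφ hχ hh hg hc hw]
    exact mul_integral_assocConv_mul_conj hμ he hψ hφ hχ hh hg hD hconv hw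
      (hD.integrable_mul_mul_conj_indicator hh.1 hg.1 hconv hs hint)

end Convolution

end LocalFieldWavelet

theorem mainTheorem4_general {K : Type*} [Field K] [ValuativeRel K] [TopologicalSpace K]
    [IsNonarchimedeanLocalField K] [MeasurableSpace K] [BorelSpace K]
    (μ : Measure K) [μ.IsAddHaarMeasure] (hμ : μ {x : K | valuation K x ≤ 1} = 1)
    (e : AddChar K Circle) (he : LocalFieldWavelet.IsFixedCharacter e)
    (ψ φ χ : K → ℂ)
    (hψ : LocalFieldWavelet.IsAdmissibleWavelet e μ ψ)
    (hφ : LocalFieldWavelet.IsAdmissibleWavelet e μ φ)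
    (hχ : MemLp χ 2 μ)
    (hcφ : LocalFieldWavelet.admissibilityConstant e μ φ ≠ 0)
    (D : K → K → K → ℂ) (hD : LocalFieldWavelet.IsBasicFunction μ ψ φ χ D)
    (h g : K → ℂ) (hh : MemLp h 2 μ) (hg : MemLp g 2 μ)
    (hconv : ∀ᵐ x ∂μ, Integrable (fun p : K × K => D x p.1 p.2 * h p.2 * g p.1) (μ.prod μ)) :
    MemLp (LocalFieldWavelet.assocConv μ D h g) 2 μ ∧
      ∀ a b : K, a ≠ 0 →
        LocalFieldWavelet.cwt μ φ (LocalFieldWavelet.assocConv μ D h g) a b =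
          LocalFieldWavelet.cwt μ ψ h a b * LocalFieldWavelet.cwt μ χ g a b := by
  have hc : (LocalFieldWavelet.admissibilityConstant e μ φ).toReal ≠ 0 :=
    (ENNReal.toReal_pos hcφ hφ.2.ne).ne'
  have hconvolution :=
    LocalFieldWavelet.assocConv_ae_eq_convolutionLp hμ he hψ hφ hχ hh hg hc hD hconv
  refine ⟨(Lp.memLp _).ae_eq hconvolution.symm, fun a b ha => ?_⟩
  rw [LocalFieldWavelet.cwt_congr hconvolution]
  exact LocalFieldWavelet.cwt_convolutionLp hμ he hψ hφ hχ hh hg hc hD ha b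

theorem mainTheorem4 {K : Type*} [Field K] [ValuativeRel K] [TopologicalSpace K]
    [IsNonarchimedeanLocalField K] [MeasurableSpace K] [BorelSpace K]
    (μ : Measure K) [μ.IsAddHaarMeasure] (hμ : μ {x : K | valuation K x ≤ 1} = 1)
    (e : AddChar K Circle) (he : LocalFieldWavelet.IsFixedCharacter e)
    (ψ φ χ : K → ℂ)
    (hψ : LocalFieldWavelet.IsAdmissibleWavelet e μ ψ)
    (hφ : LocalFieldWavelet.IsAdmissibleWavelet e μ φ)
    (hχ : LocalFieldWavelet.IsAdmissibleWavelet e μ χ)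
    (hcφ : LocalFieldWavelet.admissibilityConstant e μ φ ≠ 0)
    (D : K → K → K → ℂ) (hD : LocalFieldWavelet.IsBasicFunction μ ψ φ χ D)
    (h g : K → ℂ) (hh : MemLp h 2 μ) (hg : MemLp g 2 μ)
    (hconv : ∀ᵐ x ∂μ, Integrable (fun p : K × K => D x p.1 p.2 * h p.2 * g p.1) (μ.prod μ)) :
    MemLp (LocalFieldWavelet.assocConv μ D h g) 2 μ ∧
      ∀ a b : K, a ≠ 0 →
        LocalFieldWavelet.cwt μ φ (LocalFieldWavelet.assocConv μ D h g) a b =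
          LocalFieldWavelet.cwt μ ψ h a b * LocalFieldWavelet.cwt μ χ g a b :=
  mainTheorem4_general μ hμ e he ψ φ χ hψ hφ hχ.1 hcφ D hD h g hh hg hconv
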